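/- **Setting.** Let $T,b^I,b^R,\sigma^I,\sigma^R,\gamma^I,\gamma^R,\theta^I,\theta^R,\bar y>0$ and $a^I,a^R,\rho^I,\rho^R\in\mathbb R$. On a filtered probability space satisfying the usual conditions let $B^I,B^R$ be independent standard Brownian motions. For a nondecreasing càdlàg adapted coverage process $\xi$ on $[t,T]$ with $\xi_{t-}=y\in[0,\bar y]$, $\xi_T\le\bar y$, the exposures of the insurer and of the reinsurer are $$dX_s=(a^I-b^IX_s)ds+\sigma^IdB^I_s-d\xi_s,\ X_{t-}=x,\qquad dZ_s=(a^R-b^RZ_s)ds+\sigma^RdB^R_s+d\xi_s,\ Z_{t-}=z .$$ Put $\kappa(t)=\frac1{\theta^I}e^{-(b^I+\rho^I)(T-t)}$. The insurer answers a premium rate $c:[0,T]\to[0,\infty)$ by the law on $\mathcal Q=\mathbb R\times[0,T]\times[0,\bar y]$ with purchasing region $\{(x,t,y):c(t)\le\kappa(t),\,y<\bar y\}$ and waiting region its complement. The strategy generated by a law with waiting region $W$ and purchasing region $P$ at $(x,t,y)$ is the greatest $\xi$ such that $(X_s,s,\xi_s)\in\overline W$ for $s\in[t,T]$ and $d\xi$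 only charges times $s$ with $(X_{s-},s,\xi_{s-})\in P$ (she buys as much as possible when there is a choice). The premium $c$ is *admissible* if this strategy exists for all $(x,t,y)\in\mathcal Q$ and satisfies $\mathbb E X_T^2<\infty$, $\mathbb E\int_{[t,T]}e^{\rho^I(T-s)}c(s)\,d\xi_s<\infty$. With $\xi$ the strategy generated under $c$ at $(x,t,y)$, set $$J^R(x,t,y,z;c)=\mathbb E Z_T+\gamma^R\operatorname{Var}Z_T-\theta^R\,\mathbb E\int_{[t,T]}e^{\rho^R(T-s)}c(s)\,d\xi_s .$$ An admissible $\hat c$ is an *equilibrium premium strategy* if for all admissible $\tilde c$, all $x,z\in\mathbb R$ and $y\in[0,\bar y]$: * $\liminf_{h\downarrow0}\frac1h\big(J^R(x,t,y,z;c^h)-J^R(x,t,y,z;\hat c)\big)\ge0$ for all $t<T$, where $c^h=\tilde c$ before $t+h$ and $c^h=\hat c$ from $t+h$ on; * $J^R(x,T,y,z;\tilde c)\ge J^R(x,T,y,z;\hat c)$. Let $K(t,y,z,p)$ be the value of the cost $\mathbb E Z_T+\gamma^R\operatorname{Var}Z_T-\theta^R\mathbb E\int_{[t,T]} e^{\rho^R(T-s)}c(s)d\xi_s$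 for $c=\kappa$ and $\xi_s=y+(\bar y-y)1_{s\ge p}$ ($p=\infty$: no purchase). A *division* $(W,P)$ of $[0,T]$ consists of a closed set $P\subset[0,T]$ (purchasing) and $W=[0,T]\setminus P$ (waiting); the maximal intervals of $W$ and of $P$ are called sub waiting and sub purchasing regions. Let $p(t)=\inf(P\cap[t,T])$ and $q(t)=\inf(P\cap(t,T])$, with $\inf\emptyset=\infty$. Write $N(t,y,z,p)$ for: for every choice $\delta(h)\in[0,h]$, $\liminf_{h\downarrow0}\frac1h\big(K(t,y,z,t+\delta(h))-K(t,y,z,p)\big)\ge0$. The division is a *reinsurer's equilibrium reinsurance law* if for all $y\in[0,\bar y)$, $z\in\mathbb R$: * in a sub waiting region not containing $T$, $N(t,y,z,p(t))$ holds for all its points $t$; * in a sub waiting region containing $T$, $N(t,y,z,\infty)$ holds for all its points $t<T$, and $K(T,y,z,T)\ge K(T,y,z,\infty)$; * in a sub purchasing region with right end $t_2<T$, $N(t,y,z,t)$ holds for all its points $t$, and $K(t_2,y,z,t_2)\le K(t_2,y,z,q(t_2))$; * in a sub purchasing region containing $T$, $N(t,y,z,t)$ holds for all its points $t<T$, and $K(T,y,z,T)\le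 K(T,y,z,\infty)$. **Theorem 4.1.** Let $r=\theta^I/\theta^R$, $d=(b^I+\rho^I)-(b^R+\rho^R)$, and, where they occur, $\tau_1=T+\frac1d\ln\frac{b^Rr}{b^R+d}$, $\tau_0=T+\frac1d\ln r$. The reinsurer's equilibrium reinsurance laws $(W,P)$ are exactly the following. * I: $r>1$, $r>e^{-Td}$: $W=[0,T]$, $P=\emptyset$. * II: $r>1$, $(1+\frac d{b^R})e^{-Td}\le r\le e^{-Td}$: $W=(\tau_0,T]$, $P=[0,\tau_0]$; if $r=e^{-Td}$, also $W=[0,T]$, $P=\emptyset$. * III: $r\le1$, $r\ge(1+\frac d{b^R})e^{-Td}$, $d<0$: $W=\emptyset$, $P=[0,T]$. * IV: $r\le1$, $1+\frac d{b^R}\le r<(1+\frac d{b^R})e^{-Td}$: $W=[0,\tau_1)$, $P=[\tau_1,T]$. * V: $r<1+\frac d{b^R}$, $r<1$: $W=[0,T)$, $P=\{T\}$. * VI: $r=1$, $d>0$: $W=[0,T)$, $P=\{T\}$, or $W=[0,T]$, $P=\emptyset$. * VII: $d=0$, $r=1$: every division of $[0,T]$. * VIII: $1<r<(1+\frac d{b^R})e^{-Td}$,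 $d<0$: $W=[0,\tau_1)\cup(\tau_0,T]$, $P=[\tau_1,\tau_0]$. Moreover, for every reinsurer's equilibrium reinsurance law $(W,P)$, every $\hat c$ with $\hat c(t)=\kappa(t)$ for $t\in P$ and $\hat c(t)>\kappa(t)$ for $t\in W$ is an equilibrium premium strategy. -/

import Mathlib

open MeasureTheory ProbabilityTheory Set Filter Topology
open scoped NNReal ENNReal

namespace Reinsurance

/-- The constants of the model: horizon `T`, drift levels `aI, aR`, reversion speeds `bI, bR`,
volatilities `σI, σR`, variance weights `γI, γR`, reinsurance preferences `θI, θR`, discount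
factors `ρI, ρR` and the ceiling `ybar` on the reinsurance coverage. -/
structure Model where
  T : ℝ
  aI : ℝ
  aR : ℝ
  bI : ℝ
  bR : ℝ
  σI : ℝ
  σR : ℝ
  γI : ℝ
  γR : ℝ
  θI : ℝ
  θR : ℝ
  ρI : ℝ
  ρR : ℝ
  ybar : ℝ
  T_pos : 0 < T
  bI_pos : 0 < bI
  bR_pos : 0 < bR
  σI_pos : 0 < σI
  σR_pos : 0 < σR
  γI_pos : 0 < γI
  γR_pos : 0 < γR
  θI_pos : 0 < θI
  θR_pos : 0 < θR
  ybar_pos : 0 < ybar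

/-- A filtration satisfying the usual conditions that carries two independent standard Brownian
motions `BI`, `BR` (Brownian with respect to the filtration). -/
structure StochasticBasis (Ω : Type*) [mΩ : MeasurableSpace Ω] (μ : Measure Ω) where
  ℱ : Filtration ℝ≥0 mΩ
  BI : ℝ≥0 → Ω → ℝ
  BR : ℝ≥0 → Ω → ℝ
  right_continuous : ℱ.IsRightContinuous
  complete : ∀ N : Set Ω, μ N = 0 → MeasurableSet[ℱ 0] N
  brownian_BI : IsBrownianReal BI μ
  brownian_BR : IsBrownianReal BR μ
  adapted_BI : ∀ t, Measurable[ℱ t] (BI t)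
  adapted_BR : ∀ t, Measurable[ℱ t] (BR t)
  indep_incr_BI : ∀ s t, s ≤ t →
    Indep (MeasurableSpace.comap (fun ω => BI t ω - BI s ω) inferInstance) (ℱ s) μ
  indep_incr_BR : ∀ s t, s ≤ t →
    Indep (MeasurableSpace.comap (fun ω => BR t ω - BR s ω) inferInstance) (ℱ s) μ
  indep_BI_BR : IndepFun (fun ω (t : ℝ≥0) => BI t ω) (fun ω (t : ℝ≥0) => BR t ω) μ

/-- `X` is an adapted solution on `[t, T]` of
`dX_r = (a - b X_r) dr + σ dB_r + dA_r`, `X_{t-} = x`, where `A_{t-} = 0`.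
The initial condition at `t-` is encoded by the value `x` before time `t`. -/
structure SolvesSDE {Ω : Type*} [MeasurableSpace Ω] {μ : Measure Ω} (S : StochasticBasis Ω μ)
    (B : ℝ≥0 → Ω → ℝ) (a b σ T t x : ℝ) (A X : ℝ → Ω → ℝ) : Prop where
  before : ∀ r, r < t → ∀ ω, X r ω = x
  adapted : ∀ r ∈ Icc t T, Measurable[S.ℱ r.toNNReal] (X r)
  equation : ∀ᵐ ω ∂μ, IntervalIntegrable (fun s => X s ω) volume t T ∧
    ∀ r ∈ Icc t T, X r ω = x + (∫ s in t..r, (a - b * X s ω))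
      + σ * (B r.toNNReal ω - B t.toNNReal ω) + A r ω

/-- `ξ` is an adapted, nondecreasing, càdlàg process on `[t, T]` with `ξ_{t-} = y`, `ξ_T ≤ ybar`
(paths are extended by the constant `y` before `t` and by `ξ_T` after `T`). -/
structure IsCoverage {Ω : Type*} [MeasurableSpace Ω] {μ : Measure Ω} (S : StochasticBasis Ω μ)
    (T ybar t y : ℝ) (ξ : ℝ → Ω → ℝ) : Prop where
  before : ∀ r, r < t → ∀ ω, ξ r ω = y
  after : ∀ r, T < r → ∀ ω, ξ r ω = ξ T ω
  adapted : ∀ r ∈ Icc t T, Measurable[S.ℱ r.toNNReal] (ξ r)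
  path : ∀ᵐ ω ∂μ, Monotone (fun r => ξ r ω) ∧
    (∀ r, ContinuousWithinAt (fun s => ξ s ω) (Ici r) r) ∧ ξ T ω ≤ ybar

open Classical in
/-- The Lebesgue–Stieltjes measure `df` of a nondecreasing path (zero for other functions). -/
noncomputable def pathMeasure (f : ℝ → ℝ) : Measure ℝ :=
  if h : Monotone f then h.stieltjesFunction.measure else 0

namespace Model

/-- The state-time-control space `ℝ × [0, T] × [0, ybar]`. -/
def stateSpace (m : Model) : Set (ℝ × ℝ × ℝ) :=
  {q | q.2.1 ∈ Icc 0 m.T ∧ q.2.2 ∈ Icc 0 m.ybar}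

/-- The threshold premium rate of the insurer. -/
noncomputable def κ (m : Model) (t : ℝ) : ℝ :=
  1 / m.θI * Real.exp (-(m.bI + m.ρI) * (m.T - t))

/-- Premium preference ratio. -/
noncomputable def r (m : Model) : ℝ := m.θI / m.θR

/-- Reversion-discount difference. -/
noncomputable def d (m : Model) : ℝ := (m.bI + m.ρI) - (m.bR + m.ρR)

/-- Waiting region of the insurer's reinsurance law under the premium strategy `c`. -/
def insurerW (m : Model) (c : ℝ → ℝ) : Set (ℝ × ℝ × ℝ) :=
  {q | q.2.1 ∈ Icc 0 m.T ∧ ((q.2.2 ∈ Ico 0 m.ybar ∧ m.κ q.2.1 < c q.2.1) ∨ q.2.2 = m.ybar)}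

/-- Purchasing region of the insurer's reinsurance law under the premium strategy `c`. -/
def insurerP (m : Model) (c : ℝ → ℝ) : Set (ℝ × ℝ × ℝ) :=
  {q | q.2.1 ∈ Icc 0 m.T ∧ q.2.2 ∈ Ico 0 m.ybar ∧ c q.2.1 ≤ m.κ q.2.1}

/-- `(X, ξ)` solves the Skorohod reflection problem of the division `(W, P)` started at
`(x, t, y)`: `X` is the insurer's risk exposure under the coverage `ξ`, the triple
`(X_r, r, ξ_r)` stays in the closure of `W`, and `dξ` only charges times at which the state just
before the purchase lies in `P`. -/
structure SolvesSkorohod (m : Model) {Ω : Type*} [MeasurableSpace Ω] {μ : Measure Ω}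
    (S : StochasticBasis Ω μ) (W P : Set (ℝ × ℝ × ℝ)) (x t y : ℝ) (X ξ : ℝ → Ω → ℝ) : Prop where
  coverage : IsCoverage S m.T m.ybar t y ξ
  exposure : SolvesSDE S S.BI m.aI m.bI m.σI m.T t x (fun r ω => -(ξ r ω - y)) X
  mem_closure : ∀ᵐ ω ∂μ, ∀ r ∈ Icc t m.T, (X r ω, r, ξ r ω) ∈ closure W
  support : ∀ᵐ ω ∂μ, pathMeasure (fun r => ξ r ω)
    {u | u ∈ Icc t m.T ∧ (Function.leftLim (fun r => X r ω) u, u,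
      Function.leftLim (fun r => ξ r ω) u) ∉ P} = 0

/-- `ξ` (with exposure `X`) is the reinsurance strategy generated by the division `(W, P)` at
`(x, t, y)`. The Skorohod problem leaves the insurer a choice at some boundary times (for instance
when the purchasing region is `{T}`); by the convention that she purchases as much as possible,
the generated strategy is the greatest solution, which is unique up to null sets. -/
def IsGenerated (m : Model) {Ω : Type*} [MeasurableSpace Ω] {μ : Measure Ω}
    (S : StochasticBasis Ω μ) (W P : Set (ℝ × ℝ × ℝ)) (x t y : ℝ) (X ξ : ℝ → Ω → ℝ) : Prop :=
  m.SolvesSkorohod S W P x t y X ξ ∧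
  ∀ X' ξ' : ℝ → Ω → ℝ, m.SolvesSkorohod S W P x t y X' ξ' →
    ∀ᵐ ω ∂μ, ∀ r ∈ Icc t m.T, ξ' r ω ≤ ξ r ω

/-- Admissible reinsurance law of the insurer under the premium strategy `c`: a division of the
state space that generates, from every initial state, a strategy with square integrable terminal
exposure and finite expected discounted premium. -/
def IsAdmissibleLaw (m : Model) {Ω : Type*} [MeasurableSpace Ω] {μ : Measure Ω}
    (S : StochasticBasis Ω μ) (c : ℝ → ℝ) (W P : Set (ℝ × ℝ × ℝ)) : Prop :=
  W ∪ P = m.stateSpace ∧ Disjoint W P ∧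
  ∀ x t y : ℝ, (x, t, y) ∈ m.stateSpace → ∃ X ξ : ℝ → Ω → ℝ, m.IsGenerated S W P x t y X ξ ∧
    Integrable (fun ω => X m.T ω ^ 2) μ ∧
    (∫⁻ ω, ∫⁻ s in Icc t m.T, ENNReal.ofReal (Real.exp (m.ρI * (m.T - s)) * c s)
      ∂(pathMeasure (fun s => ξ s ω)) ∂μ) < ⊤

/-- Admissible premium strategies: nonnegative on `[0, T]`, and the insurer's response (her
threshold law) is an admissible law. -/
def IsAdmissiblePremium (m : Model) {Ω : Type*} [MeasurableSpace Ω] {μ : Measure Ω}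
    (S : StochasticBasis Ω μ) (c : ℝ → ℝ) : Prop :=
  (∀ t ∈ Icc 0 m.T, 0 ≤ c t) ∧ m.IsAdmissibleLaw S c (m.insurerW c) (m.insurerP c)

/-- The reinsurer's mean-variance cost
`E Z_T + γR Var Z_T - θR E ∫_{[t,T]} e^{ρR (T-s)} c(s) dξ_s`
when the coverage is `ξ` with `ξ_{t-} = y`, the premium rate is `c` and `Z_{t-} = z`; here `Z` is
the (almost surely unique) solution of `dZ = (aR - bR Z) dr + σR dBR + dξ`. -/
noncomputable def coverageCost (m : Model) {Ω : Type*} [MeasurableSpace Ω] {μ : Measure Ω}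
    (S : StochasticBasis Ω μ) (t y z : ℝ) (c : ℝ → ℝ) (ξ : ℝ → Ω → ℝ) : ℝ :=
  let Z : ℝ → Ω → ℝ := Classical.epsilon fun Z =>
    SolvesSDE S S.BR m.aR m.bR m.σR m.T t z (fun r ω => ξ r ω - y) Z
  (∫ ω, Z m.T ω ∂μ) + m.γR * variance (Z m.T) μ
    - m.θR * ∫ ω, (∫ s in Icc t m.T, Real.exp (m.ρR * (m.T - s)) * c s
        ∂(pathMeasure (fun s => ξ s ω))) ∂μ

/-- The reinsurer's objective `J^R(x, t, y, z; c)`: his cost when the coverage is the strategy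
generated at `(x, t, y)` by the insurer's law under `c`. -/
noncomputable def JR (m : Model) {Ω : Type*} [MeasurableSpace Ω] {μ : Measure Ω}
    (S : StochasticBasis Ω μ) (x t y z : ℝ) (c : ℝ → ℝ) : ℝ :=
  m.coverageCost S t y z c
    (Classical.epsilon fun ξ => ∃ X, m.IsGenerated S (m.insurerW c) (m.insurerP c) x t y X ξ)

open Classical in
/-- The premium strategy that follows `c₁` before time `s` and `c₂` from time `s` on. -/
noncomputable def paste (s : ℝ) (c₁ c₂ : ℝ → ℝ) : ℝ → ℝ :=
  fun u => if u < s then c₁ u else c₂ u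

/-- Equilibrium premium strategy of the reinsurer. -/
def IsEquilibriumPremium (m : Model) {Ω : Type*} [MeasurableSpace Ω] {μ : Measure Ω}
    (S : StochasticBasis Ω μ) (c : ℝ → ℝ) : Prop :=
  m.IsAdmissiblePremium S c ∧
  (∀ x z : ℝ, ∀ t ∈ Ico 0 m.T, ∀ y ∈ Icc 0 m.ybar, ∀ c' : ℝ → ℝ, m.IsAdmissiblePremium S c' →
    0 ≤ liminf (fun h : ℝ =>
      (((m.JR S x t y z (paste (t + h) c' c) - m.JR S x t y z c) / h : ℝ) : EReal)) (𝓝[>] 0)) ∧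
  (∀ x z : ℝ, ∀ y ∈ Icc 0 m.ybar, ∀ c' : ℝ → ℝ, m.IsAdmissiblePremium S c' →
    0 ≤ m.JR S x m.T y z c' - m.JR S x m.T y z c)

open Classical in
/-- `K(t, y, z, p)`: the reinsurer's cost when all the remaining reinsurance `ybar - y` is sold at
time `p` at the threshold premium `κ(p)` (`p = ⊤`: no sale). -/
noncomputable def K (m : Model) {Ω : Type*} [MeasurableSpace Ω] {μ : Measure Ω}
    (S : StochasticBasis Ω μ) (t y z : ℝ) (p : WithTop ℝ) : ℝ :=
  m.coverageCost S t y z m.κ (fun s _ => if p ≤ (s : WithTop ℝ) then m.ybar else y)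

end Model

open Classical in
/-- The first point of a set of times (`⊤` if the set is empty). -/
noncomputable def firstTime (A : Set ℝ) : WithTop ℝ :=
  if A.Nonempty then ((sInf A : ℝ) : WithTop ℝ) else ⊤

/-- A nonempty maximal interval contained in `A`. -/
def IsSubRegion (A I : Set ℝ) : Prop :=
  Maximal (fun J : Set ℝ => J ⊆ A ∧ J.OrdConnected ∧ J.Nonempty) I

/-- A division of `[0, T]` into a waiting region `W` and a purchasing region `P`. `P` is closed, so
the maximal intervals of `P` have the form `[t₁, t₂]`, and those of `W` the form `(t₁, t₂)`,
`[0, t₂)`, `(t₁, T]` or `[0, T]`. -/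
def IsDivision (T : ℝ) (W P : Set ℝ) : Prop :=
  W ∪ P = Icc 0 T ∧ Disjoint W P ∧ IsClosed P

namespace Model

/-- Selling at any time in `[t, t + h]` instead of `p` is, to first order in `h`, not better. -/
def NoLocalGain (m : Model) {Ω : Type*} [MeasurableSpace Ω] {μ : Measure Ω}
    (S : StochasticBasis Ω μ) (t y z : ℝ) (p : WithTop ℝ) : Prop :=
  ∀ δ : ℝ → ℝ, (∀ h, 0 < h → δ h ∈ Icc 0 h) →
    0 ≤ liminf (fun h : ℝ =>
      (((m.K S t y z ((t + δ h : ℝ) : WithTop ℝ) - m.K S t y z p) / h : ℝ) : EReal)) (𝓝[>] 0)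

/-- Reinsurer's equilibrium reinsurance law `(W, P)`. -/
structure IsEquilibriumLaw (m : Model) {Ω : Type*} [MeasurableSpace Ω] {μ : Measure Ω}
    (S : StochasticBasis Ω μ) (W P : Set ℝ) : Prop where
  division : IsDivision m.T W P
  /-- sub waiting regions that are followed by a purchasing time -/
  sub_waiting : ∀ I, IsSubRegion W I → m.T ∉ I → ∀ t ∈ I, ∀ y ∈ Ico 0 m.ybar, ∀ z : ℝ,
    m.NoLocalGain S t y z (firstTime (P ∩ Icc t m.T))
  /-- the last sub waiting region -/
  last_waiting : ∀ I, IsSubRegion W I → m.T ∈ I → ∀ y ∈ Ico 0 m.ybar, ∀ z : ℝ,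
    (∀ t ∈ I, t < m.T → m.NoLocalGain S t y z (firstTime (P ∩ Icc t m.T))) ∧
    0 ≤ m.K S m.T y z (m.T : ℝ) - m.K S m.T y z ⊤
  /-- sub purchasing regions that end before the horizon; the second condition compares selling at
  the end `t₂` of the region with selling at the next purchasing time -/
  sub_purchasing : ∀ I, IsSubRegion P I → m.T ∉ I → ∀ y ∈ Ico 0 m.ybar, ∀ z : ℝ,
    (∀ t ∈ I, m.NoLocalGain S t y z (t : ℝ)) ∧
    ∀ t₂, IsGreatest I t₂ → m.K S t₂ y z (t₂ : ℝ) ≤ m.K S t₂ y z (firstTime (P ∩ Ioc t₂ m.T))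
  /-- the last sub purchasing region -/
  last_purchasing : ∀ I, IsSubRegion P I → m.T ∈ I → ∀ y ∈ Ico 0 m.ybar, ∀ z : ℝ,
    (∀ t ∈ I, t < m.T → m.NoLocalGain S t y z (t : ℝ)) ∧
    m.K S m.T y z (m.T : ℝ) ≤ m.K S m.T y z ⊤

/-- The premium strategies generated by a division `(W, P)` of `[0, T]`. -/
def GeneratesPremium (m : Model) (W P : Set ℝ) (c : ℝ → ℝ) : Prop :=
  (∀ t ∈ P, c t = m.κ t) ∧ (∀ t ∈ W, m.κ t < c t)

/-! The eight parameter regions, as sets of pairs `(d, r)`. -/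

def regionI (m : Model) : Set (ℝ × ℝ) :=
  {q | 1 < q.2 ∧ Real.exp (-m.T * q.1) < q.2}

def regionII (m : Model) : Set (ℝ × ℝ) :=
  {q | 1 < q.2 ∧ q.2 ≤ Real.exp (-m.T * q.1) ∧
    (1 + q.1 / m.bR) * Real.exp (-m.T * q.1) ≤ q.2}

def regionIII (m : Model) : Set (ℝ × ℝ) :=
  {q | q.2 ≤ 1 ∧ (1 + q.1 / m.bR) * Real.exp (-m.T * q.1) ≤ q.2 ∧ q.1 < 0}

def regionIV (m : Model) : Set (ℝ × ℝ) :=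
  {q | q.2 ≤ 1 ∧ q.2 < (1 + q.1 / m.bR) * Real.exp (-m.T * q.1) ∧ 1 + q.1 / m.bR ≤ q.2}

def regionV (m : Model) : Set (ℝ × ℝ) :=
  {q | q.2 < 1 + q.1 / m.bR ∧ q.2 < 1}

def regionVI : Set (ℝ × ℝ) := {q | q.2 = 1 ∧ 0 < q.1}

def regionVII : Set (ℝ × ℝ) := {(0, 1)}

def regionVIII (m : Model) : Set (ℝ × ℝ) :=
  {q | 1 < q.2 ∧ q.2 < (1 + q.1 / m.bR) * Real.exp (-m.T * q.1) ∧ q.1 < 0}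

/-- The time after which the reinsurer starts selling. -/
noncomputable def startTime (m : Model) : ℝ :=
  m.T + 1 / m.d * Real.log (m.bR * m.r / (m.bR + m.d))

/-- The time after which the reinsurer stops selling. -/
noncomputable def cutoffTime (m : Model) : ℝ := m.T + 1 / m.d * Real.log m.r

end Model

end Reinsurance

/-! Everything reduces to one scalar function of time. The reinsurer's equation is linear, so a jump
of the coverage at a deterministic time `p` adds a deterministic term to `Z_T`: the mean shifts, the
variance does not change. Hence selling all of `ybar - y` at `p` costs `C + (ybar - y) * saleCost c
p`, where `C` depends only on `t` and `z` (`exists_coverageCost_eq`), and differences of costs no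
longer see the noise. At the threshold premium the cost per unit is `unitCost`.

The local conditions then become pointwise ones (`noLocalGain_iff`): selling now is strictly dearer
than the planned sale, or equally dear with a nonnegative derivative. So the equilibrium laws are
the solutions of `IsUnitLaw` (`isEquilibriumLaw_iff`). With `discount s = exp (-d (T - s))`, the
sign of `unitCost` is that of `r - discount` and the sign of its derivative is that of `bR * r - (bR
+ d) * discount`. As `discount` is monotone, each sign changes at most once, at `cutoffTime` and
`startTime` respectively, and the regions list the resulting shapes of `unitCost` on `[0, T]`.

For the premium statement, the insurer's response to an admissible premium must be identified.
Existence of a greatest Skorohod solution forces the accepted times to have an attained first point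
after every `t` (`IsAdmissiblePremium.attainsFirst`), and the response is then to buy everything at
that point (`exists_isGenerated_stepPath`). A deviation on `[t, t + h)` either sells there, at a
premium at most `κ`, hence at a cost of at least `unitCost`, or postpones the sale to the first
purchasing time after `t + h`. `NoUnitGain.eventually` controls the first case,
`eventually_le_saleCost_firstTime` the second; the latter uses from the classification that `P` is
an interval unless `unitCost` vanishes. -/

namespace Reinsurance

/-! ### Step paths and their Stieltjes measures -/

open Classical in
/-- The path that equals `y` before `p` and `Y` from `p` on. -/
noncomputable def stepPath (p : WithTop ℝ) (y Y : ℝ) (s : ℝ) : ℝ :=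
  if p ≤ (s : WithTop ℝ) then Y else y

@[simp] lemma stepPath_top (y Y s : ℝ) : stepPath ⊤ y Y s = y := by simp [stepPath]

lemma stepPath_of_le {p : WithTop ℝ} {y Y s : ℝ} (h : p ≤ s) : stepPath p y Y s = Y := if_pos h

lemma stepPath_of_lt {p : WithTop ℝ} {y Y s : ℝ} (h : s < p) : stepPath p y Y s = y :=
  if_neg (not_le.2 h)

lemma monotone_stepPath (p : WithTop ℝ) {y Y : ℝ} (h : y ≤ Y) : Monotone (stepPath p y Y) := by
  intro s u hsu
  rcases le_or_gt p (s : WithTop ℝ) with hp | hp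
  · rw [stepPath_of_le hp, stepPath_of_le (hp.trans (WithTop.coe_le_coe.2 hsu))]
  · rw [stepPath_of_lt hp]
    rcases le_or_gt p (u : WithTop ℝ) with hu | hu
    · rwa [stepPath_of_le hu]
    · rw [stepPath_of_lt hu]

lemma continuousWithinAt_stepPath (p : WithTop ℝ) (y Y s : ℝ) :
    ContinuousWithinAt (stepPath p y Y) (Ici s) s := by
  rcases le_or_gt p (s : WithTop ℝ) with hp | hp
  · refine (continuousWithinAt_const (b := Y)).congr (fun u hu => ?_) (stepPath_of_le hp)
    exact stepPath_of_le (hp.trans (WithTop.coe_le_coe.2 hu))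
  · refine ContinuousAt.continuousWithinAt ?_
    refine (continuousAt_const (y := y)).congr ?_
    induction p using WithTop.recTopCoe with
    | top => exact Eventually.of_forall fun u => (stepPath_top y Y u).symm
    | coe p =>
      filter_upwards [Iio_mem_nhds (WithTop.coe_lt_coe.1 hp)] with u hu
      exact (stepPath_of_lt (WithTop.coe_lt_coe.2 hu)).symm

lemma leftLim_eq_of_forall_lt {f : ℝ → ℝ} {a y : ℝ} (t : ℝ) (hta : t < a)
    (h : ∀ s ∈ Ioo t a, f s = y) : Function.leftLim f a = y := by
  refine leftLim_eq_of_tendsto ?_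
  refine tendsto_const_nhds.congr' ?_
  filter_upwards [Ioo_mem_nhdsLT hta] with s hs using (h s hs).symm

lemma leftLim_stepPath_self (p y Y : ℝ) : Function.leftLim (stepPath (p : WithTop ℝ) y Y) p = y :=
  leftLim_eq_of_forall_lt (p - 1) (by linarith) fun _ hs =>
    stepPath_of_lt (WithTop.coe_lt_coe.2 hs.2)

lemma stieltjesFunction_apply {f : ℝ → ℝ} (hf : Monotone f)
    (hc : ∀ r, ContinuousWithinAt f (Ici r) r) (x : ℝ) : hf.stieltjesFunction x = f x := by
  rw [hf.stieltjesFunction_eq]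
  exact rightLim_eq_of_tendsto ((hc x).mono Ioi_subset_Ici_self)

/-- The left limit at `t` is the value `y` taken before `t`, so a purchase at the initial time
itself is counted. -/
lemma pathMeasure_Icc {f : ℝ → ℝ} (hf : Monotone f)
    (hc : ∀ r, ContinuousWithinAt f (Ici r) r) {y t s : ℝ} (hy : ∀ r < t, f r = y) :
    pathMeasure f (Icc t s) = ENNReal.ofReal (f s - y) := by
  have h : (hf.stieltjesFunction : ℝ → ℝ) = f := funext (stieltjesFunction_apply hf hc)
  rw [pathMeasure, dif_pos hf, StieltjesFunction.measure_Icc, h,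
    leftLim_eq_of_forall_lt (t - 1) (by linarith) (fun r hr => hy r hr.2)]

lemma pathMeasure_Ioc {f : ℝ → ℝ} (hf : Monotone f)
    (hc : ∀ r, ContinuousWithinAt f (Ici r) r) (a b : ℝ) :
    pathMeasure f (Ioc a b) = ENNReal.ofReal (f b - f a) := by
  rw [pathMeasure, dif_pos hf, StieltjesFunction.measure_Ioc, stieltjesFunction_apply hf hc,
    stieltjesFunction_apply hf hc]

lemma isLocallyFiniteMeasure_pathMeasure (f : ℝ → ℝ) :
    IsLocallyFiniteMeasure (pathMeasure f) := by
  unfold pathMeasure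
  split_ifs <;> infer_instance

lemma pathMeasure_stepPath_coe (p : ℝ) {y Y : ℝ} (h : y ≤ Y) :
    pathMeasure (stepPath (p : WithTop ℝ) y Y) = ENNReal.ofReal (Y - y) • Measure.dirac p := by
  have := isLocallyFiniteMeasure_pathMeasure (stepPath (p : WithTop ℝ) y Y)
  refine Measure.ext_of_Ioc _ _ fun a b hab => ?_
  rw [pathMeasure_Ioc (monotone_stepPath _ h) (continuousWithinAt_stepPath _ _ _)]
  simp only [Measure.smul_apply, Measure.dirac_apply, smul_eq_mul]
  by_cases hap : a < p
  · rw [stepPath_of_lt (WithTop.coe_lt_coe.2 hap)]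
    by_cases hpb : p ≤ b
    · rw [stepPath_of_le (WithTop.coe_le_coe.2 hpb), indicator_of_mem (show p ∈ Ioc a b from ⟨hap, hpb⟩)]
      simp
    · rw [stepPath_of_lt (WithTop.coe_lt_coe.2 (not_le.1 hpb)),
        indicator_of_notMem (fun h => hpb h.2)]
      simp
  · rw [stepPath_of_le (WithTop.coe_le_coe.2 (not_lt.1 hap)),
      stepPath_of_le (WithTop.coe_le_coe.2 ((not_lt.1 hap).trans hab.le)),
      indicator_of_notMem (fun h => hap h.1)]
    simp

lemma pathMeasure_stepPath_top (y Y : ℝ) : pathMeasure (stepPath ⊤ y Y) = 0 := by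
  have := isLocallyFiniteMeasure_pathMeasure (stepPath ⊤ y Y)
  refine Measure.ext_of_Ioc _ _ fun a b hab => ?_
  have hm : Monotone (stepPath ⊤ y Y) := fun a b _ => by simp
  rw [pathMeasure_Ioc hm (continuousWithinAt_stepPath _ _ _)]
  simp

lemma integral_pathMeasure_stepPath_coe {t T p y Y : ℝ} (hp : p ∈ Icc t T) (h : y ≤ Y)
    (f : ℝ → ℝ) :
    ∫ s in Icc t T, f s ∂(pathMeasure (stepPath (p : WithTop ℝ) y Y)) = (Y - y) * f p := by
  rw [pathMeasure_stepPath_coe p h, Measure.restrict_smul, integral_smul_measure,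
    Measure.restrict_eq_self_of_ae_mem, integral_dirac, ENNReal.toReal_ofReal (by linarith),
    smul_eq_mul]
  rw [ae_dirac_eq]
  exact hp

/-- Finiteness of the expected premium only needs an upper bound, so `p` may lie anywhere. The
default `0` for `p = ⊤` is harmless, since the measure is then zero. -/
lemma lintegral_pathMeasure_stepPath_le (t T : ℝ) (p : WithTop ℝ) {y Y : ℝ} (h : y ≤ Y)
    (f : ℝ → ℝ) :
    ∫⁻ s in Icc t T, ENNReal.ofReal (f s) ∂(pathMeasure (stepPath p y Y)) ≤
      ENNReal.ofReal (Y - y) * ENNReal.ofReal (f (p.untopD 0)) := by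
  induction p using WithTop.recTopCoe with
  | top => simp [pathMeasure_stepPath_top]
  | coe p =>
    refine (lintegral_mono' Measure.restrict_le_self le_rfl).trans ?_
    rw [pathMeasure_stepPath_coe p h, lintegral_smul_measure, lintegral_dirac]
    simp

/-! ### Pathwise linear equations: uniqueness, jump response, explicit solution -/

/-- The forcing cancels in the difference `D`, leaving `D = -b ∫ D`. Thus `D` is continuous, and
Grönwall applied to its primitive gives zero. `F` needs no regularity, so jumps are allowed. -/
lemma eqOn_of_linear_integral_equation {u v F : ℝ → ℝ} {b t T : ℝ} (a x : ℝ) (htT : t ≤ T)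
    (hu : IntervalIntegrable u volume t T) (hv : IntervalIntegrable v volume t T)
    (eu : ∀ r ∈ Icc t T, u r = x + (∫ s in t..r, (a - b * u s)) + F r)
    (ev : ∀ r ∈ Icc t T, v r = x + (∫ s in t..r, (a - b * v s)) + F r) :
    ∀ r ∈ Icc t T, u r = v r := by
  have hsub : ∀ r ∈ Icc t T, Set.uIcc t r ⊆ Set.uIcc t T := fun r hr => by
    rw [uIcc_of_le hr.1, uIcc_of_le htT]; exact Icc_subset_Icc_right hr.2
  set D : ℝ → ℝ := fun r => u r - v r with hD
  have hDi : IntervalIntegrable D volume t T := hu.sub hv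
  have hDeq : ∀ r ∈ Icc t T, D r = -b * ∫ s in t..r, D s := by
    intro r hr
    have h1 : IntervalIntegrable u volume t r := hu.mono_set (hsub r hr)
    have h2 : IntervalIntegrable v volume t r := hv.mono_set (hsub r hr)
    simp only [hD]
    rw [eu r hr, ev r hr, intervalIntegral.integral_sub h1 h2,
      intervalIntegral.integral_sub (by simp) (h1.const_mul b),
      intervalIntegral.integral_sub (by simp) (h2.const_mul b),
      intervalIntegral.integral_const_mul, intervalIntegral.integral_const_mul]
    ring
  have hprim : ContinuousOn (fun r => ∫ s in t..r, D s) (Icc t T) := by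
    have := intervalIntegral.continuousOn_primitive_interval' hDi (left_mem_uIcc)
    rwa [uIcc_of_le htT] at this
  have hDc : ContinuousOn D (Icc t T) := (hprim.const_smul (-b)).congr fun r hr => by
    simpa using hDeq r hr
  -- A continuous extension of `D` beyond `[t, T]` makes the primitive differentiable everywhere,
  -- endpoints included.
  set e : ℝ → ℝ := IccExtend htT ((Icc t T).domRestrict D)
  have he : Continuous e := hDc.domRestrict.Icc_extend'
  have heD : ∀ r ∈ Icc t T, e r = D r := fun r hr => by
    simp [e, IccExtend_of_mem htT _ hr, Set.domRestrict_apply]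
  have hJ : ∀ r ∈ Icc t T, ∫ s in t..r, e s = ∫ s in t..r, D s := fun r hr =>
    intervalIntegral.integral_congr fun s hs => by
      rw [uIcc_of_le hr.1] at hs
      exact heD s ⟨hs.1, hs.2.trans hr.2⟩
  have hder : ∀ r, HasDerivAt (fun r => ∫ s in t..r, e s) (e r) r := fun r =>
    intervalIntegral.integral_hasDerivAt_right (he.intervalIntegrable _ _)
      (he.stronglyMeasurableAtFilter _ _) he.continuousAt
  have hzero := eq_zero_of_abs_deriv_le_mul_abs_self_of_eq_zero_right
    (f := fun r => ∫ s in t..r, e s) (f' := e) (K := |b|) (a := t) (b := T)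
    (fun r _ => (hder r).continuousAt.continuousWithinAt) (fun r _ => (hder r).hasDerivWithinAt)
    (by simp) (fun r hr => by
      have hr' : r ∈ Icc t T := ⟨hr.1, hr.2.le⟩
      rw [heD r hr', hDeq r hr', hJ r hr', norm_mul, norm_neg, Real.norm_eq_abs b])
  intro r hr
  have h0 := hDeq r hr
  have h1 : ∫ s in t..r, e s = 0 := hzero r hr
  rw [← hJ r hr, h1] at h0
  simp only [hD] at h0
  linarith

/-- Response of a mean-reverting linear equation to a jump of size `c` at time `p`. -/
noncomputable def jumpResponse (b : ℝ) (p : WithTop ℝ) (c s : ℝ) : ℝ :=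
  stepPath p 0 (c * Real.exp (-b * (s - p.untopD 0))) s

@[simp] lemma jumpResponse_top (b c s : ℝ) : jumpResponse b ⊤ c s = 0 := by simp [jumpResponse]

lemma jumpResponse_of_le (b : ℝ) {p : ℝ} (c : ℝ) {s : ℝ} (h : p ≤ s) :
    jumpResponse b (p : WithTop ℝ) c s = c * Real.exp (-b * (s - p)) := by
  rw [jumpResponse, stepPath_of_le (WithTop.coe_le_coe.2 h)]; rfl

lemma jumpResponse_of_lt (b : ℝ) {p : WithTop ℝ} (c : ℝ) {s : ℝ} (h : s < p) :
    jumpResponse b p c s = 0 := by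
  rw [jumpResponse, stepPath_of_lt h]

lemma intervalIntegrable_jumpResponse (b : ℝ) (p : WithTop ℝ) (c t r : ℝ) :
    IntervalIntegrable (jumpResponse b p c) volume t r := by
  induction p using WithTop.recTopCoe with
  | top =>
    have : jumpResponse b ⊤ c = fun _ => 0 := by ext; simp
    rw [this]; simp
  | coe p =>
    have : jumpResponse b (p : WithTop ℝ) c =
        (Ici p).indicator (fun s => c * Real.exp (-b * (s - p))) := by
      ext s
      by_cases h : p ≤ s
      · rw [jumpResponse_of_le b c h, indicator_of_mem (show s ∈ Ici p from h)]
      · rw [jumpResponse_of_lt b c (WithTop.coe_lt_coe.2 (not_le.1 h)),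
          indicator_of_notMem (show s ∉ Ici p from h)]
    rw [this]
    have hc : Continuous (fun s => c * Real.exp (-b * (s - p))) := by fun_prop
    exact ⟨(hc.intervalIntegrable t r).1.indicator measurableSet_Ici,
      (hc.intervalIntegrable t r).2.indicator measurableSet_Ici⟩

lemma jumpResponse_eq (b : ℝ) {p : WithTop ℝ} (c : ℝ) {t r : ℝ} (hp : t ≤ p) (hr : t ≤ r) :
    jumpResponse b p c r = stepPath p 0 c r - b * ∫ s in t..r, jumpResponse b p c s := by
  induction p using WithTop.recTopCoe with
  | top => simp
  | coe p =>
    have hp : t ≤ p := WithTop.coe_le_coe.1 hp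
    have hz : ∀ u, u ≤ p → t ≤ u → ∫ s in t..u, jumpResponse b p c s = 0 := by
      intro u hu htu
      rw [intervalIntegral.integral_congr_Ioo_of_le (g := fun _ => 0) htu]
      · simp
      · intro s hs
        exact jumpResponse_of_lt b c (WithTop.coe_lt_coe.2 (hs.2.trans_le hu))
    rcases lt_or_ge r p with h | h
    · rw [hz r h.le hr, jumpResponse_of_lt b c (WithTop.coe_lt_coe.2 h),
        stepPath_of_lt (WithTop.coe_lt_coe.2 h)]
      simp
    · rw [← intervalIntegral.integral_add_adjacent_intervals
        (intervalIntegrable_jumpResponse b p c t p) (intervalIntegrable_jumpResponse b p c p r),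
        hz p le_rfl hp, zero_add, jumpResponse_of_le b c h, stepPath_of_le (WithTop.coe_le_coe.2 h),
        intervalIntegral.integral_congr (g := fun s => c * Real.exp (-b * (s - p))),
        ← intervalIntegral.integral_const_mul]
      · have hd : ∀ s ∈ uIcc p r, HasDerivAt (fun s => -(c * Real.exp (-b * (s - p))))
            (b * (c * Real.exp (-b * (s - p)))) s := by
          intro s _
          have h1 : HasDerivAt (fun s => -b * (s - p)) (-b) s := by
            simpa using ((hasDerivAt_id s).sub_const p).const_mul (-b)
          refine (h1.exp.const_mul c).neg.congr_deriv ?_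
          ring
        rw [intervalIntegral.integral_eq_sub_of_hasDerivAt hd
          (Continuous.intervalIntegrable (by fun_prop) _ _)]
        simp
      · intro s hs
        rw [uIcc_of_le h] at hs
        exact jumpResponse_of_le b c hs.1

/-- Pathwise solution of `dX = (a - b X) ds + dF`, `X_t = x`, for a continuous path `F` with
`F t = 0`. -/
noncomputable def ouPath (a b t x : ℝ) (F : ℝ → ℝ) (r : ℝ) : ℝ :=
  F r + Real.exp (-b * (r - t)) * (x + ∫ s in t..r, Real.exp (b * (s - t)) * (a - b * F s))

lemma continuous_ouPath (a b t x : ℝ) {F : ℝ → ℝ} (hF : Continuous F) :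
    Continuous (ouPath a b t x F) := by
  have : Continuous fun r => ∫ s in t..r, Real.exp (b * (s - t)) * (a - b * F s) :=
    intervalIntegral.continuous_primitive
      (fun u v => Continuous.intervalIntegrable (by fun_prop) u v) t
  unfold ouPath
  fun_prop

/-- Variation of constants: `F` is merely continuous, but `ouPath - F` is differentiable with
derivative `a - b * ouPath`, and only this difference is differentiated. -/
lemma ouPath_eq (a b t x : ℝ) {F : ℝ → ℝ} (hF : Continuous F) (r : ℝ) :
    ouPath a b t x F r = x + (∫ s in t..r, (a - b * ouPath a b t x F s)) + F r := by
  have hX := continuous_ouPath a b t x hF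
  have hd : ∀ s ∈ uIcc t r, HasDerivAt (fun s => ouPath a b t x F s - F s)
      (a - b * ouPath a b t x F s) s := by
    intro s _
    have hw : Continuous fun s => Real.exp (b * (s - t)) * (a - b * F s) := by fun_prop
    have h2 : HasDerivAt (fun r => ∫ s in t..r, Real.exp (b * (s - t)) * (a - b * F s))
        (Real.exp (b * (s - t)) * (a - b * F s)) s :=
      intervalIntegral.integral_hasDerivAt_right (hw.intervalIntegrable _ _)
        (hw.stronglyMeasurableAtFilter _ _) hw.continuousAt
    have h1 : HasDerivAt (fun s => -b * (s - t)) (-b) s := by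
      simpa using ((hasDerivAt_id s).sub_const t).const_mul (-b)
    have h3 := h1.exp.mul (h2.const_add x)
    have hE : Real.exp (-b * (s - t)) * Real.exp (b * (s - t)) = 1 := by
      rw [← Real.exp_add]; simp
    have hfun : (fun s => ouPath a b t x F s - F s) = (fun s => Real.exp (-b * (s - t)) *
        (x + ∫ s in t..s, Real.exp (b * (s - t)) * (a - b * F s))) := by
      ext s; simp [ouPath]
    rw [hfun]
    refine h3.congr_deriv ?_
    simp only [ouPath]
    linear_combination (a - b * F s) * hE
  have := intervalIntegral.integral_eq_sub_of_hasDerivAt hd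
    (Continuous.intervalIntegrable (by fun_prop) _ _)
  rw [this]
  simp [ouPath, add_comm]

/-- Continuity in time gives joint measurability. The σ-algebra is arbitrary so that it can be a
member of the filtration, which yields adaptedness. -/
lemma stronglyMeasurable_intervalIntegral {Ω : Type*} {m : MeasurableSpace Ω} {G : ℝ → Ω → ℝ}
    (hc : ∀ ω, Continuous fun s => G s ω) (hm : ∀ s, Measurable[m] (G s)) {t T : ℝ} (h : t ≤ T) :
    StronglyMeasurable[m] fun ω => ∫ s in t..T, G s ω := by
  simp_rw [intervalIntegral.integral_of_le h]
  have : StronglyMeasurable[inferInstanceAs (MeasurableSpace (Ω × ℝ))]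
      (Function.uncurry fun ω s => G s ω) :=
    ((measurable_uncurry_of_continuous_of_measurable hc hm).comp measurable_swap).stronglyMeasurable
  exact this.integral_prod_right

/-- Measurability and moments of `F` are known on `[t, T]` only; clipping time makes the integrand
well behaved for every real `s` without changing the integral. -/
lemma ouPath_clip {a b t x T : ℝ} (h : t ≤ T) (F : ℝ → ℝ) :
    ouPath a b t x F T = F T + Real.exp (-b * (T - t)) * (x + ∫ s in t..T,
      Real.exp (b * (max t (min s T) - t)) * (a - b * F (max t (min s T)))) := by
  unfold ouPath
  congr 3
  refine intervalIntegral.integral_congr fun s hs => ?_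
  rw [uIcc_of_le h] at hs
  simp only [min_eq_left hs.2, max_eq_right hs.1]

lemma measurable_ouPath {Ω : Type*} {m : MeasurableSpace Ω} {F : ℝ → Ω → ℝ} {a b t x r : ℝ} (h : t ≤ r)
    (hc : ∀ ω, Continuous fun s => F s ω) (hm : ∀ s ∈ Icc t r, Measurable[m] (F s)) :
    Measurable[m] fun ω => ouPath a b t x (fun s => F s ω) r := by
  simp_rw [ouPath_clip h]
  refine (hm r ⟨h, le_rfl⟩).add (((stronglyMeasurable_intervalIntegral (fun ω => ?_)
    (fun s => ?_) h).measurable.const_add x).const_mul _)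
  · have := hc ω
    fun_prop
  · exact (((hm _ ⟨le_max_left _ _, max_le h (min_le_right _ _)⟩).const_mul b).const_sub a).const_mul _

/-! ### The exposure equation: existence, uniqueness, square integrability -/

section StochasticEquation

variable {Ω : Type*} [mΩ : MeasurableSpace Ω] {μ : Measure Ω}

lemma SolvesSDE.ae_eq {S : StochasticBasis Ω μ} {B : ℝ≥0 → Ω → ℝ} {a b σ T t x : ℝ}
    {A A' X X' : ℝ → Ω → ℝ} (htT : t ≤ T) (h : SolvesSDE S B a b σ T t x A X)
    (h' : SolvesSDE S B a b σ T t x A' X')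
    (hA : ∀ᵐ ω ∂μ, ∀ r ∈ Icc t T, A r ω = A' r ω) :
    ∀ᵐ ω ∂μ, ∀ r ∈ Icc t T, X r ω = X' r ω := by
  filter_upwards [h.equation, h'.equation, hA] with ω h1 h2 h3
  refine eqOn_of_linear_integral_equation (b := b)
    (F := fun r => σ * (B r.toNNReal ω - B t.toNNReal ω) + A r ω) a x htT h1.1 h2.1
    (fun r hr => ?_) (fun r hr => ?_)
  · rw [h1.2 r hr, add_assoc]
  · rw [h2.2 r hr, h3 r hr, add_assoc]

lemma SolvesSDE.congr {S : StochasticBasis Ω μ} {B : ℝ≥0 → Ω → ℝ} {a b σ T t x : ℝ}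
    {A A' X : ℝ → Ω → ℝ} (h : SolvesSDE S B a b σ T t x A X)
    (hA : ∀ᵐ ω ∂μ, ∀ r ∈ Icc t T, A r ω = A' r ω) : SolvesSDE S B a b σ T t x A' X where
  before := h.before
  adapted := h.adapted
  equation := by
    filter_upwards [h.equation, hA] with ω h1 h2
    exact ⟨h1.1, fun r hr => by rw [h1.2 r hr, h2 r hr]⟩

/-- Linearity: the jump contributes its own deterministic response, added to the solution without
purchase. This is why purchases at deterministic times leave the variance unchanged. -/
lemma SolvesSDE.add_jump {S : StochasticBasis Ω μ} {B : ℝ≥0 → Ω → ℝ} {a b σ T t x : ℝ}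
    {X : ℝ → Ω → ℝ} (htT : t ≤ T) (h : SolvesSDE S B a b σ T t x (fun _ _ => 0) X)
    {p : WithTop ℝ} (hp : t ≤ p) (c : ℝ) :
    SolvesSDE S B a b σ T t x (fun r _ => stepPath p 0 c r)
      (fun r ω => X r ω + jumpResponse b p c r) where
  before r hr ω := by
    rw [h.before r hr, jumpResponse_of_lt b c ((WithTop.coe_lt_coe.2 hr).trans_le hp), add_zero]
  adapted r hr := (h.adapted r hr).add_const _
  equation := by
    filter_upwards [h.equation] with ω hω
    have hJ := intervalIntegrable_jumpResponse b p c
    refine ⟨hω.1.add (hJ t T), fun r hr => ?_⟩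
    have hX : IntervalIntegrable (fun s => X s ω) volume t r := hω.1.mono_set (by
      rw [uIcc_of_le hr.1, uIcc_of_le htT]; exact Icc_subset_Icc_right hr.2)
    have hsplit : (fun s => a - b * (X s ω + jumpResponse b p c s)) =
        fun s => (a - b * X s ω) - b * jumpResponse b p c s := by ext s; ring
    rw [hsplit, intervalIntegral.integral_sub ((by simp : IntervalIntegrable (fun _ => a) volume t r).sub
      (hX.const_mul b)) ((hJ t r).const_mul b), intervalIntegral.integral_const_mul,
      hω.2 r hr, jumpResponse_eq b c hp hr.1]
    ring

/-- The null set of discontinuous paths belongs to `ℱ 0` by completeness, so setting `B` to zero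
there preserves adaptedness. -/
lemma StochasticBasis.exists_continuous_version (S : StochasticBasis Ω μ) {B : ℝ≥0 → Ω → ℝ}
    (hB : IsBrownianReal B μ) (had : ∀ t, Measurable[S.ℱ t] (B t)) :
    ∃ B' : ℝ≥0 → Ω → ℝ, (∀ ω, Continuous fun t => B' t ω) ∧ (∀ t, Measurable[S.ℱ t] (B' t)) ∧
      ∀ᵐ ω ∂μ, ∀ t, B' t ω = B t ω := by
  set N : Set Ω := {ω | ¬ Continuous fun t => B t ω} with hN
  have hN0 : μ N = 0 := hB.cont
  have hNm : ∀ t, MeasurableSet[S.ℱ t] N := fun t => S.ℱ.mono zero_le _ (S.complete N hN0)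
  refine ⟨fun t => Nᶜ.indicator (B t), fun ω => ?_, fun t => ?_, ?_⟩
  · by_cases h : ω ∈ N
    · have : (fun t => Nᶜ.indicator (B t) ω) = fun _ => 0 := by
        ext t; exact indicator_of_notMem (fun h' : ω ∈ Nᶜ => h' h) _
      rw [this]; exact continuous_const
    · have : (fun t => Nᶜ.indicator (B t) ω) = fun t => B t ω := by
        ext t; exact indicator_of_mem (show ω ∈ Nᶜ from h) _
      rw [this]; exact not_not.1 h
  · exact Measurable.indicator (had t) (hNm t).compl
  · filter_upwards [hB.cont] with ω hω t
    exact indicator_of_mem (show ω ∈ Nᶜ from fun h => h hω) _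

/-- Cauchy–Schwarz against the constant function, obtained by expanding `∫ (f * (T - t) - ∫ f)² ≥
0`. -/
lemma sq_intervalIntegral_le {f : ℝ → ℝ} (hf : Continuous f) {t T : ℝ} (h : t ≤ T) :
    (∫ s in t..T, f s) ^ 2 ≤ (T - t) * ∫ s in t..T, f s ^ 2 := by
  rcases h.eq_or_lt with rfl | h
  · simp
  set I := ∫ s in t..T, f s with hI
  have h0 : 0 ≤ ∫ s in t..T, (f s * (T - t) - I) ^ 2 :=
    intervalIntegral.integral_nonneg h.le fun _ _ => sq_nonneg _
  have h1 : ∫ s in t..T, (f s * (T - t) - I) ^ 2 =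
      (T - t) * ((T - t) * (∫ s in t..T, f s ^ 2) - I ^ 2) := by
    have : (fun s => (f s * (T - t) - I) ^ 2) =
        fun s => (T - t) ^ 2 * f s ^ 2 - 2 * (T - t) * I * f s + I ^ 2 := by ext; ring
    have i1 : IntervalIntegrable (fun s => (T - t) ^ 2 * f s ^ 2) volume t T :=
      Continuous.intervalIntegrable (by fun_prop) _ _
    have i2 : IntervalIntegrable (fun s => 2 * (T - t) * I * f s) volume t T :=
      Continuous.intervalIntegrable (by fun_prop) _ _
    rw [this, intervalIntegral.integral_add (i1.sub i2) (by simp),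
      intervalIntegral.integral_sub i1 i2, intervalIntegral.integral_const_mul,
      intervalIntegral.integral_const_mul, ← hI, intervalIntegral.integral_const, smul_eq_mul]
    ring
  rw [h1] at h0
  have := nonneg_of_mul_nonneg_right h0 (by linarith : 0 < T - t)
  linarith

lemma memLp_intervalIntegral [IsFiniteMeasure μ] {G : ℝ → Ω → ℝ}
    (hc : ∀ ω, Continuous fun s => G s ω) (hm : ∀ s, Measurable (G s)) {t T C : ℝ} (h : t ≤ T)
    (hL : ∀ s, MemLp (G s) 2 μ) (hC : ∀ s, ∫ ω, G s ω ^ 2 ∂μ ≤ C) :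
    MemLp (fun ω => ∫ s in t..T, G s ω) 2 μ := by
  have hJ := measurable_uncurry_of_continuous_of_measurable hc hm
  have hJ2 : Measurable (fun q : ℝ × Ω => G q.1 q.2 ^ 2) := hJ.pow_const 2
  have hI : Integrable (fun q : ℝ × Ω => G q.1 q.2 ^ 2) ((volume.restrict (Ioc t T)).prod μ) := by
    rw [integrable_prod_iff hJ2.aestronglyMeasurable]
    refine ⟨Eventually.of_forall fun s => (hL s).integrable_sq, ?_⟩
    refine Integrable.mono' (g := fun _ => C) (integrable_const C)
      hJ2.norm.aestronglyMeasurable.integral_prod_right' (Eventually.of_forall fun s => ?_)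
    rw [Real.norm_of_nonneg (by positivity)]
    simpa using hC s
  have hI2 := hI.integral_prod_right
  have hS := (stronglyMeasurable_intervalIntegral hc hm h).aestronglyMeasurable (μ := μ)
  refine (memLp_two_iff_integrable_sq hS).2 ((hI2.const_mul (T - t)).mono' (hS.pow 2)
    (Eventually.of_forall fun ω => ?_))
  rw [Real.norm_of_nonneg (by positivity)]
  have := sq_intervalIntegral_le (hc ω) h
  rwa [intervalIntegral.integral_of_le (f := fun s => G s ω ^ 2) h] at this

lemma memLp_ouPath [IsFiniteMeasure μ] {F : ℝ → Ω → ℝ} {a b t x T C : ℝ} (h : t ≤ T)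
    (hc : ∀ ω, Continuous fun s => F s ω) (hm : ∀ s ∈ Icc t T, Measurable (F s))
    (hL : ∀ s ∈ Icc t T, MemLp (F s) 2 μ) (hC : ∀ s ∈ Icc t T, ∫ ω, F s ω ^ 2 ∂μ ≤ C) :
    MemLp (fun ω => ouPath a b t x (fun s => F s ω) T) 2 μ := by
  simp_rw [ouPath_clip h]
  have hcl : ∀ s, max t (min s T) ∈ Icc t T := fun s =>
    ⟨le_max_left _ _, max_le h (min_le_right _ _)⟩
  have hG : ∀ s, MemLp (fun ω => Real.exp (b * (max t (min s T) - t)) *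
      (a - b * F (max t (min s T)) ω)) 2 μ := fun s =>
    ((memLp_const a).sub ((hL _ (hcl s)).const_mul b)).const_mul _
  refine (hL T ⟨h, le_rfl⟩).add (((memLp_const x).add (memLp_intervalIntegral
    -- The exponential weight is at most `exp (|b| (T - t))` on the clipped times, and `(a - b F)² ≤
    -- 2 a² + 2 b² F²`.
    (C := Real.exp (|b| * (T - t)) ^ 2 * (2 * a ^ 2 * μ.real univ + 2 * b ^ 2 * C))
    (fun ω => ?_) (fun s => ?_) h hG fun s => ?_)).const_mul _)
  · have := hc ω
    fun_prop
  · exact (((hm _ (hcl s)).const_mul b).const_sub a).const_mul _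
  · have hi : Integrable (fun ω => Real.exp (|b| * (T - t)) ^ 2 *
        (2 * a ^ 2 + 2 * b ^ 2 * F (max t (min s T)) ω ^ 2)) μ :=
      ((integrable_const _).add ((hL _ (hcl s)).integrable_sq.const_mul _)).const_mul _
    refine (integral_mono (hG s).integrable_sq hi fun ω => ?_).trans ?_
    · simp only [mul_pow]
      have h1 : Real.exp (b * (max t (min s T) - t)) ≤ Real.exp (|b| * (T - t)) := by
        refine Real.exp_le_exp.2 (mul_le_mul (le_abs_self b) ?_ ?_ (abs_nonneg b))
        · linarith [(hcl s).2]
        · linarith [(hcl s).1]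
      have h2 : (a - b * F (max t (min s T)) ω) ^ 2 ≤
          2 * a ^ 2 + 2 * b ^ 2 * F (max t (min s T)) ω ^ 2 := by
        nlinarith [sq_nonneg (a + b * F (max t (min s T)) ω)]
      exact mul_le_mul (pow_le_pow_left₀ (Real.exp_nonneg _) h1 2) h2 (sq_nonneg _)
        (sq_nonneg _)
    · rw [integral_const_mul, integral_add (integrable_const _)
        ((hL _ (hcl s)).integrable_sq.const_mul _), integral_const_mul, integral_const, smul_eq_mul,
        mul_comm (μ.real univ), integral_const_mul]
      have := mul_le_mul_of_nonneg_left (hC _ (hcl s)) (by positivity : 0 ≤ 2 * b ^ 2)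
      exact mul_le_mul_of_nonneg_left (by linarith) (sq_nonneg _)

lemma exists_solvesSDE [IsProbabilityMeasure μ] (S : StochasticBasis Ω μ) {B : ℝ≥0 → Ω → ℝ}
    (hB : IsBrownianReal B μ) (had : ∀ t, Measurable[S.ℱ t] (B t)) (a b σ x : ℝ) {t T : ℝ}
    (htT : t ≤ T) :
    ∃ X : ℝ → Ω → ℝ, SolvesSDE S B a b σ T t x (fun _ _ => 0) X ∧ MemLp (X T) 2 μ := by
  obtain ⟨B', hcont, hmeas, hae⟩ := S.exists_continuous_version hB had
  set F : ℝ → Ω → ℝ := fun s ω => σ * (B' s.toNNReal ω - B' t.toNNReal ω) with hF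
  have hFc : ∀ ω, Continuous fun s => F s ω := fun ω => by
    have := (hcont ω).comp continuous_real_toNNReal
    exact continuous_const.mul (this.sub continuous_const)
  have hFm : ∀ r, ∀ s ∈ Icc t r, Measurable[S.ℱ r.toNNReal] (F s) := fun r s hs =>
    (((hmeas _).mono (S.ℱ.mono (Real.toNNReal_le_toNNReal hs.2)) le_rfl).sub
      ((hmeas _).mono (S.ℱ.mono (Real.toNNReal_le_toNNReal (hs.1.trans hs.2))) le_rfl)).const_mul σ
  have hlaw : ∀ s : ℝ, HasLaw (fun ω => B' s.toNNReal ω - B' t.toNNReal ω)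
      (gaussianReal 0 (nndist s.toNNReal.1 t.toNNReal.1)) μ := fun s =>
    (hB.hasLaw_sub s.toNNReal t.toNNReal).congr (by
      filter_upwards [hae] with ω hω
      simp [hω])
  have hFL : ∀ s : ℝ, MemLp (fun ω => B' s.toNNReal ω - B' t.toNNReal ω) 2 μ := fun s => by
    have h1 := memLp_id_gaussianReal (μ := 0) (v := nndist s.toNNReal.1 t.toNNReal.1) 2
    rw [← (hlaw s).map_eq, memLp_map_measure_iff aestronglyMeasurable_id (hlaw s).aemeasurable] at h1
    exact h1
  -- The increment has variance `|s⁺ - t⁺|`; the bound is a crude triangle inequality that does not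
  -- require `t ≥ 0`.
  have hFC : ∀ s ∈ Icc t T, ∫ ω, F s ω ^ 2 ∂μ ≤ σ ^ 2 * (|T| + |t| + |t|) := fun s hs => by
    have h1 : Var[fun ω => B' s.toNNReal ω - B' t.toNNReal ω; μ] =
        (nndist s.toNNReal.1 t.toNNReal.1 : ℝ) := by
      rw [(hlaw s).variance_eq, variance_id_gaussianReal]
    have h2 : ∫ ω, (B' s.toNNReal ω - B' t.toNNReal ω) ∂μ = 0 := by
      rw [(hlaw s).integral_eq, integral_id_gaussianReal]
    rw [variance_of_integral_eq_zero (hlaw s).aemeasurable h2] at h1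
    simp only [hF, mul_pow, integral_const_mul]
    rw [h1]
    refine mul_le_mul_of_nonneg_left ?_ (sq_nonneg σ)
    rw [coe_nndist, Real.dist_eq]
    refine (abs_sub _ _).trans ?_
    have e1 : |(s.toNNReal.1 : ℝ)| ≤ |s| := by
      change |max s 0| ≤ |s|
      rw [abs_of_nonneg (le_max_right _ _)]
      exact max_le (le_abs_self _) (abs_nonneg _)
    have e2 : |(t.toNNReal.1 : ℝ)| ≤ |t| := by
      change |max t 0| ≤ |t|
      rw [abs_of_nonneg (le_max_right _ _)]
      exact max_le (le_abs_self _) (abs_nonneg _)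
    have e3 : |s| ≤ |T| + |t| := abs_le.2
      ⟨by linarith [hs.1, neg_abs_le t, abs_nonneg T], by linarith [hs.2, le_abs_self T, abs_nonneg t]⟩
    linarith
  classical
  refine ⟨fun r ω => if r < t then x else ouPath a b t x (fun s => F s ω) r,
    ⟨fun r hr ω => if_pos hr, fun r hr => ?_, ?_⟩, ?_⟩
  · simp only [not_lt.2 hr.1, if_false]
    exact measurable_ouPath hr.1 hFc (hFm r)
  · filter_upwards [hae] with ω hω
    have hcg : ∀ r ∈ Icc t T, EqOn (fun s => if s < t then x else ouPath a b t x (fun s => F s ω) s)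
        (ouPath a b t x (fun s => F s ω)) (uIcc t r) := fun r hr s hs => by
      rw [uIcc_of_le hr.1] at hs
      simp [not_lt.2 hs.1]
    refine ⟨?_, fun r hr => ?_⟩
    · refine (((continuous_ouPath a b t x (hFc ω)).intervalIntegrable t T)).congr fun s hs => ?_
      exact (hcg T ⟨htT, le_rfl⟩ (uIoc_subset_uIcc hs)).symm
    · rw [intervalIntegral.integral_congr (g := fun s => a - b * ouPath a b t x (fun s => F s ω) s)]
      · have := ouPath_eq a b t x (hFc ω) r
        simp only [not_lt.2 hr.1, if_false]
        rw [this]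
        simp [hF, hω]
      · intro s hs
        have := hcg r hr hs
        simp only at this ⊢
        rw [this]
  · simp only [not_lt.2 htT, if_false]
    exact memLp_ouPath htT hFc (fun s hs => (hFm T s hs).mono (S.ℱ.le _) le_rfl)
      (fun s _ => (hFL s).const_mul σ) hFC

end StochasticEquation

/-! ### The cost of one sale at a deterministic time -/

namespace Model

/-- Cost of selling one unit of coverage at time `p` at the premium rate `c` (`⊤`: no sale). -/
noncomputable def saleCost (m : Model) (c : ℝ → ℝ) (p : WithTop ℝ) : ℝ :=
  (p.map fun s => Real.exp (-m.bR * (m.T - s)) -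
    m.θR * (Real.exp (m.ρR * (m.T - s)) * c s)).untopD 0

@[simp] lemma saleCost_top (m : Model) (c : ℝ → ℝ) : m.saleCost c ⊤ = 0 := rfl

lemma saleCost_coe (m : Model) (c : ℝ → ℝ) (s : ℝ) : m.saleCost c (s : WithTop ℝ) =
    Real.exp (-m.bR * (m.T - s)) - m.θR * (Real.exp (m.ρR * (m.T - s)) * c s) := rfl

/-- Cost of selling one unit of coverage at time `s` at the threshold premium. -/
noncomputable def unitCost (m : Model) (s : ℝ) : ℝ :=
  Real.exp (-m.bR * (m.T - s)) - Real.exp (-(m.bR + m.d) * (m.T - s)) / m.r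

/-- The derivative of `unitCost`. -/
noncomputable def unitCost' (m : Model) (s : ℝ) : ℝ :=
  m.bR * Real.exp (-m.bR * (m.T - s)) -
    (m.bR + m.d) * Real.exp (-(m.bR + m.d) * (m.T - s)) / m.r

lemma r_pos (m : Model) : 0 < m.r := div_pos m.θI_pos m.θR_pos

lemma κ_pos (m : Model) (t : ℝ) : 0 < m.κ t := by
  have := m.θI_pos
  unfold κ; positivity

/-- The definition of `d` merges the premium discount with the exponential in `κ` into the rate
`-(bR + d)`, and `θR / θI = 1 / r`. -/
lemma saleCost_κ (m : Model) (s : ℝ) : m.saleCost m.κ (s : WithTop ℝ) = m.unitCost s := by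
  have h1 := m.θI_pos.ne'
  have h2 := m.θR_pos.ne'
  have h : Real.exp (-(m.bR + m.d) * (m.T - s)) =
      Real.exp (m.ρR * (m.T - s)) * Real.exp (-(m.bI + m.ρI) * (m.T - s)) := by
    rw [← Real.exp_add]; congr 1; unfold d; ring
  rw [saleCost_coe, unitCost, h, κ, r]
  field_simp

lemma hasDerivAt_unitCost (m : Model) (s : ℝ) : HasDerivAt m.unitCost (m.unitCost' s) s := by
  have h (b : ℝ) : HasDerivAt (fun s => Real.exp (-b * (m.T - s)))
      (b * Real.exp (-b * (m.T - s))) s := by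
    have h1 : HasDerivAt (fun s => -b * (m.T - s)) b s := by
      simpa using ((hasDerivAt_id s).const_sub m.T).const_mul (-b)
    simpa [mul_comm] using h1.exp
  exact (h m.bR).sub ((h (m.bR + m.d)).div_const m.r)

variable {Ω : Type*} [MeasurableSpace Ω] {μ : Measure Ω} [IsProbabilityMeasure μ]

/-- `Z_T` is the no-sale exposure plus a constant, so its variance does not depend on the sale. `C`
is chosen before `y`, `c`, `p` and `ξ`, hence cancels whenever two strategies are compared from the
same `t` and `z`. -/
lemma exists_coverageCost_eq (m : Model) (S : StochasticBasis Ω μ) {t : ℝ} (ht : t ≤ m.T) (z : ℝ) :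
    ∃ C : ℝ, ∀ (y : ℝ) (c : ℝ → ℝ) (p : WithTop ℝ) (ξ : ℝ → Ω → ℝ), y ≤ m.ybar →
      (p = ⊤ ∨ ∃ s ∈ Icc t m.T, p = (s : WithTop ℝ)) →
      (∀ᵐ ω ∂μ, ∀ s, ξ s ω = stepPath p y m.ybar s) →
      m.coverageCost S t y z c ξ = C + (m.ybar - y) * m.saleCost c p := by
  obtain ⟨Z₀, hZ₀, hL⟩ := exists_solvesSDE S S.brownian_BR S.adapted_BR m.aR m.bR m.σR z ht
  refine ⟨(∫ ω, Z₀ m.T ω ∂μ) + m.γR * variance (Z₀ m.T) μ, fun y c p ξ hy hp hξ => ?_⟩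
  have htp : t ≤ p := by
    rcases hp with rfl | ⟨s, hs, rfl⟩
    · exact le_top
    · exact WithTop.coe_le_coe.2 hs.1
  have hstep : ∀ s, stepPath p y m.ybar s - y = stepPath p 0 (m.ybar - y) s := fun s => by
    unfold stepPath; split_ifs <;> ring
  have hZ := hZ₀.add_jump ht htp (m.ybar - y)
  have hA : ∀ᵐ ω ∂μ, ∀ r ∈ Icc t m.T, stepPath p 0 (m.ybar - y) r = ξ r ω - y := by
    filter_upwards [hξ] with ω hω r _
    rw [hω, hstep]
  have hex : ∃ Z, SolvesSDE S S.BR m.aR m.bR m.σR m.T t z (fun r ω => ξ r ω - y) Z :=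
    ⟨_, hZ.congr hA⟩
  -- The cost is defined through an arbitrarily chosen solution; pathwise uniqueness identifies it
  -- almost surely with the explicit one.
  have hZe := Classical.epsilon_spec hex
  unfold coverageCost
  set Z := Classical.epsilon fun Z =>
    SolvesSDE S S.BR m.aR m.bR m.σR m.T t z (fun r ω => ξ r ω - y) Z
  have hae : Z m.T =ᵐ[μ] fun ω => Z₀ m.T ω + jumpResponse m.bR p (m.ybar - y) m.T := by
    filter_upwards [hZe.ae_eq ht hZ (hA.mono fun ω h r hr => (h r hr).symm)] with ω hω
    exact hω m.T ⟨ht, le_rfl⟩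
  have hprem : ∫ ω, (∫ s in Icc t m.T, Real.exp (m.ρR * (m.T - s)) * c s
      ∂(pathMeasure (fun s => ξ s ω))) ∂μ = ∫ s in Icc t m.T, Real.exp (m.ρR * (m.T - s)) * c s
      ∂(pathMeasure (stepPath p y m.ybar)) := by
    rw [integral_congr_ae (g := fun _ => ∫ s in Icc t m.T, Real.exp (m.ρR * (m.T - s)) * c s
      ∂(pathMeasure (stepPath p y m.ybar)))]
    · simp
    · filter_upwards [hξ] with ω hω
      rw [show (fun s => ξ s ω) = stepPath p y m.ybar from funext hω]
  simp only
  rw [hprem, integral_congr_ae hae, variance_congr hae,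
    variance_add_const hL.aestronglyMeasurable,
    integral_add (hL.integrable one_le_two) (integrable_const _)]
  rcases hp with rfl | ⟨s, hs, rfl⟩
  · simp [pathMeasure_stepPath_top]
  · rw [integral_pathMeasure_stepPath_coe hs hy (fun s => Real.exp (m.ρR * (m.T - s)) * c s),
      saleCost_coe, jumpResponse_of_le _ _ hs.2]
    simp
    ring

lemma exists_K_eq (m : Model) (S : StochasticBasis Ω μ) {t : ℝ} (ht : t ≤ m.T) (z : ℝ) :
    ∃ C : ℝ, ∀ (y : ℝ) (p : WithTop ℝ), y ≤ m.ybar →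
      (p = ⊤ ∨ ∃ s ∈ Icc t m.T, p = (s : WithTop ℝ)) →
      m.K S t y z p = C + (m.ybar - y) * m.saleCost m.κ p := by
  obtain ⟨C, hC⟩ := m.exists_coverageCost_eq S ht z
  exact ⟨C, fun y p hy hp => hC y m.κ p _ hy hp (Eventually.of_forall fun ω s => rfl)⟩

end Model

/-! ### First-order conditions in terms of the unit cost -/

lemma zero_le_liminf_coe_iff (f : ℝ → ℝ) :
    0 ≤ liminf (fun h : ℝ => (f h : EReal)) (𝓝[>] 0) ↔
      ∀ ε > 0, ∀ᶠ h in 𝓝[>] 0, -ε ≤ f h := by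
  constructor
  · intro h ε hε
    have : ((-ε : ℝ) : EReal) < liminf (fun h : ℝ => (f h : EReal)) (𝓝[>] 0) :=
      lt_of_lt_of_le (by exact_mod_cast neg_lt_zero.2 hε) h
    filter_upwards [eventually_lt_of_lt_liminf this] with x hx
    exact (EReal.coe_lt_coe_iff.1 hx).le
  · intro h
    refine le_of_forall_lt fun a ha => ?_
    obtain ⟨q, hq1, hq2⟩ := EReal.lt_iff_exists_real_btwn.1 ha
    have hq : 0 < -q := by
      have : q < 0 := by exact_mod_cast hq2
      linarith
    refine hq1.trans_le (le_liminf_of_le (by isBoundedDefault) ?_)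
    filter_upwards [h (-q) hq] with x hx
    exact EReal.coe_le_coe_iff.2 (by linarith)

namespace Model

/-- Selling immediately at time `t` is, to first order, not better than selling at time `p`. -/
def NoUnitGain (m : Model) (t : ℝ) (p : WithTop ℝ) : Prop :=
  m.saleCost m.κ p < m.unitCost t ∨ (m.saleCost m.κ p = m.unitCost t ∧ 0 ≤ m.unitCost' t)

/-- With strict inequality, continuity suffices; with equality, the first-order expansion at `t`
loses at most `ε * δ`. Uniformity in `δ ∈ [0, h]` covers every choice of sale time in the window. -/
lemma NoUnitGain.eventually {m : Model} {t : ℝ} {p : WithTop ℝ} (h : m.NoUnitGain t p) {ε : ℝ}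
    (hε : 0 < ε) :
    ∀ᶠ h in 𝓝[>] (0 : ℝ), ∀ δ ∈ Icc 0 h, -(ε * h) ≤ m.unitCost (t + δ) - m.saleCost m.κ p := by
  suffices ∃ η > 0, ∀ δ, 0 ≤ δ → δ < η →
      -(ε * δ) ≤ m.unitCost (t + δ) - m.saleCost m.κ p by
    obtain ⟨η, hη, H⟩ := this
    filter_upwards [Ioo_mem_nhdsGT hη] with h hh δ hδ
    have h1 := H δ hδ.1 (hδ.2.trans_lt hh.2)
    have h2 := mul_le_mul_of_nonneg_left hδ.2 hε.le
    linarith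
  rcases h with h | ⟨h, h'⟩
  · have hc : ContinuousAt m.unitCost t := (m.hasDerivAt_unitCost t).continuousAt
    obtain ⟨η, hη, H⟩ := Metric.eventually_nhds_iff.1 (hc.eventually (lt_mem_nhds h))
    refine ⟨η, hη, fun δ h0 h1 => ?_⟩
    have := H (y := t + δ) (by rw [Real.dist_eq]; simpa [abs_of_nonneg h0] using h1)
    have := mul_nonneg hε.le h0
    linarith
  · have hd := (m.hasDerivAt_unitCost t)
    rw [hasDerivAt_iff_isLittleO] at hd
    obtain ⟨η, hη, H⟩ := Metric.eventually_nhds_iff.1 (hd.def hε)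
    refine ⟨η, hη, fun δ h0 h1 => ?_⟩
    have := H (y := t + δ) (by rw [Real.dist_eq]; simpa [abs_of_nonneg h0] using h1)
    rw [show t + δ - t = δ by ring, Real.norm_eq_abs, Real.norm_eq_abs, abs_of_nonneg h0,
      smul_eq_mul] at this
    have h2 := (abs_le.1 this).1
    have h3 := mul_nonneg h0 h'
    rw [h]
    linarith

variable {Ω : Type*} [MeasurableSpace Ω] {μ : Measure Ω} [IsProbabilityMeasure μ]

/-- Two choices of `δ` carry the forward direction: `δ = 0` excludes a positive gain from selling at
once, which divided by `h` would diverge, and in the case of equality `δ(h) = h` turns the quotient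
into the right slope of `unitCost`. -/
lemma noLocalGain_iff (m : Model) (S : StochasticBasis Ω μ) {t y : ℝ} (ht : t < m.T)
    (hy : y < m.ybar) (z : ℝ) {p : WithTop ℝ}
    (hp : p = ⊤ ∨ ∃ s ∈ Icc t m.T, p = (s : WithTop ℝ)) :
    m.NoLocalGain S t y z p ↔ m.NoUnitGain t p := by
  obtain ⟨C, hC⟩ := m.exists_K_eq S ht.le z
  have hy' : 0 < m.ybar - y := sub_pos.2 hy
  have hK : ∀ δ : ℝ, 0 ≤ δ → δ < m.T - t → m.K S t y z ((t + δ : ℝ) : WithTop ℝ) - m.K S t y z p =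
      (m.ybar - y) * (m.unitCost (t + δ) - m.saleCost m.κ p) := fun δ h0 h1 => by
    rw [hC y _ hy.le (Or.inr ⟨t + δ, ⟨by linarith, by linarith⟩, rfl⟩), hC y p hy.le hp, saleCost_κ]
    ring
  have hsmall : Ioo 0 (m.T - t) ∈ 𝓝[>] (0 : ℝ) := Ioo_mem_nhdsGT (sub_pos.2 ht)
  constructor
  · intro H
    have h0 := (zero_le_liminf_coe_iff _).1 (H (fun _ => 0) fun h hh => ⟨le_rfl, hh.le⟩)
    have hle : m.saleCost m.κ p ≤ m.unitCost t := by
      by_contra! hlt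
      set a := (m.ybar - y) * (m.saleCost m.κ p - m.unitCost t) with ha
      have hapos : 0 < a := mul_pos hy' (sub_pos.2 hlt)
      -- The quotient is `-a / h`, which is below `-a / 2` as soon as `h < 1`.
      obtain ⟨h, h1, h2, h3⟩ := ((h0 (a / 2) (by linarith)).and
        ((Filter.inter_mem hsmall (Ioo_mem_nhdsGT one_pos)))).exists
      rw [hK 0 le_rfl (sub_pos.2 ht), add_zero, le_div_iff₀ h3.1] at h1
      have : a / 2 * h ≤ a / 2 := mul_le_of_le_one_right (by linarith) h3.2.le
      linarith
    rcases hle.lt_or_eq with hlt | heq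
    · exact Or.inl hlt
    refine Or.inr ⟨heq, ?_⟩
    have h1 := (zero_le_liminf_coe_iff _).1 (H (fun h => max h 0)
      fun h hh => ⟨le_max_right _ _, by rw [max_eq_left hh.le]⟩)
    have hder := (m.hasDerivAt_unitCost t).hasDerivWithinAt (s := Ioi t)
    rw [hasDerivWithinAt_iff_tendsto_slope' (by simp)] at hder
    have hmap : Tendsto (fun h : ℝ => t + h) (𝓝[>] 0) (𝓝[>] t) := by
      refine tendsto_nhdsWithin_iff.2 ⟨?_, ?_⟩
      · have : Tendsto (fun h : ℝ => t + h) (𝓝 0) (𝓝 (t + 0)) :=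
          (continuous_const.add continuous_id).tendsto 0
        rw [add_zero] at this
        exact this.mono_left nhdsWithin_le_nhds
      · filter_upwards [self_mem_nhdsWithin] with h hh
        exact lt_add_of_pos_right t hh
    have hlim := hder.comp hmap
    refine le_of_forall_pos_lt_add fun ε hε => ?_
    have hge : -(ε / 2) ≤ m.unitCost' t := by
      refine ge_of_tendsto hlim ?_
      filter_upwards [h1 ((m.ybar - y) * (ε / 2)) (by positivity), hsmall] with h hh hh2
      rw [hK _ (le_max_right _ _) (by rw [max_eq_left hh2.1.le]; exact hh2.2), max_eq_left hh2.1.le,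
        mul_div_assoc, ← mul_neg, mul_le_mul_iff_right₀ hy', heq] at hh
      simp only [Function.comp, slope_def_field, add_sub_cancel_left]
      exact hh
    linarith
  · intro H δ hδ
    refine (zero_le_liminf_coe_iff _).2 fun ε hε => ?_
    filter_upwards [H.eventually (div_pos hε hy'), hsmall] with h h1 h2
    have hδh := hδ h h2.1
    have h3 := h1 (δ h) hδh
    rw [hK _ hδh.1 (hδh.2.trans_lt h2.2), le_div_iff₀ h2.1]
    have h4 := mul_le_mul_of_nonneg_left h3 hy'.le
    have h5 : (m.ybar - y) * -(ε / (m.ybar - y) * h) = -ε * h := by field_simp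
    linarith

end Model

/-! ### Maximal intervals, first times and divisions -/

lemma isSubRegion_ordConnectedComponent {A : Set ℝ} {x : ℝ} (hx : x ∈ A) :
    IsSubRegion A (A.ordConnectedComponent x) := by
  refine ⟨⟨ordConnectedComponent_subset, inferInstance, nonempty_ordConnectedComponent.2 hx⟩, ?_⟩
  intro J hJ hle
  have := hJ.2.1
  exact subset_ordConnectedComponent (hle (self_mem_ordConnectedComponent.2 hx)) hJ.1

lemma IsSubRegion.eq_of_ordConnected {A I : Set ℝ} (hI : IsSubRegion A I) (hA : A.OrdConnected) :
    I = A := by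
  have hne : A.Nonempty := hI.1.2.2.mono hI.1.1
  exact hI.eq_of_subset ⟨Subset.rfl, hA, hne⟩ hI.1.1

lemma firstTime_empty : firstTime ∅ = ⊤ := by simp [firstTime]

lemma firstTime_eq_coe {A : Set ℝ} {s : ℝ} (h : IsLeast A s) : firstTime A = (s : WithTop ℝ) := by
  rw [firstTime, if_pos h.nonempty, h.csInf_eq]

lemma firstTime_cases {A : Set ℝ} (hc : IsClosed A) (hb : BddBelow A) :
    (A = ∅ ∧ firstTime A = ⊤) ∨ ∃ s, IsLeast A s ∧ firstTime A = (s : WithTop ℝ) := by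
  rcases A.eq_empty_or_nonempty with rfl | hne
  · exact Or.inl ⟨rfl, firstTime_empty⟩
  · exact Or.inr ⟨sInf A, hc.isLeast_csInf hne hb, firstTime_eq_coe (hc.isLeast_csInf hne hb)⟩

/-- Since `Ioc t T` omits `t`, the infimum need not be attained; its location in `[t, T]` is enough
for the cost formula. -/
lemma firstTime_Ioc (P : Set ℝ) (t T : ℝ) :
    firstTime (P ∩ Ioc t T) = ⊤ ∨ ∃ s ∈ Icc t T, firstTime (P ∩ Ioc t T) = (s : WithTop ℝ) := by
  rcases (P ∩ Ioc t T).eq_empty_or_nonempty with he | hne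
  · exact Or.inl (by rw [he, firstTime_empty])
  · refine Or.inr ⟨sInf (P ∩ Ioc t T), ⟨le_csInf hne fun s hs => hs.2.1.le, ?_⟩,
      by rw [firstTime, if_pos hne]⟩
    obtain ⟨s, hs⟩ := hne
    exact (csInf_le ⟨t, fun _ hs => hs.2.1.le⟩ hs).trans hs.2.2

namespace IsDivision

variable {T : ℝ} {W P : Set ℝ}

lemma subset_left (h : IsDivision T W P) : W ⊆ Icc 0 T := h.1 ▸ subset_union_left

lemma subset_right (h : IsDivision T W P) : P ⊆ Icc 0 T := h.1 ▸ subset_union_right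

lemma left_eq (h : IsDivision T W P) : W = Icc 0 T \ P := by
  rw [← h.1, union_sdiff_right]
  exact h.2.1.sdiff_eq_left.symm

lemma mem_left (h : IsDivision T W P) {t : ℝ} (ht : t ∈ Icc 0 T) (hP : t ∉ P) : t ∈ W := by
  rw [h.left_eq]; exact ⟨ht, hP⟩

lemma firstTime_Icc (h : IsDivision T W P) (t : ℝ) :
    (P ∩ Icc t T = ∅ ∧ firstTime (P ∩ Icc t T) = ⊤) ∨
      ∃ s, IsLeast (P ∩ Icc t T) s ∧ firstTime (P ∩ Icc t T) = (s : WithTop ℝ) :=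
  firstTime_cases (h.2.2.inter isClosed_Icc) ⟨t, fun _ hs => hs.2.1⟩

lemma firstTime_Icc' (h : IsDivision T W P) (t : ℝ) :
    firstTime (P ∩ Icc t T) = ⊤ ∨ ∃ s ∈ Icc t T, firstTime (P ∩ Icc t T) = (s : WithTop ℝ) := by
  rcases h.firstTime_Icc t with h | ⟨s, hs, h⟩
  · exact Or.inl h.2
  · exact Or.inr ⟨s, hs.1.2, h⟩

end IsDivision

/-! ### Equilibrium laws as conditions on the unit cost -/

namespace Model

/-- The conditions of an equilibrium reinsurance law in terms of the cost of selling one unit. -/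
structure IsUnitLaw (m : Model) (W P : Set ℝ) : Prop where
  division : IsDivision m.T W P
  waiting : ∀ t ∈ W, t < m.T → m.NoUnitGain t (firstTime (P ∩ Icc t m.T))
  waiting_end : m.T ∈ W → 0 ≤ m.unitCost m.T
  purchasing : ∀ t ∈ P, t < m.T → 0 ≤ m.unitCost' t
  gap : ∀ I, IsSubRegion P I → m.T ∉ I → ∀ t, IsGreatest I t →
    m.unitCost t ≤ m.saleCost m.κ (firstTime (P ∩ Ioc t m.T))
  purchasing_end : m.T ∈ P → m.unitCost m.T ≤ 0

lemma noUnitGain_self_iff (m : Model) (t : ℝ) :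
    m.NoUnitGain t (t : WithTop ℝ) ↔ 0 ≤ m.unitCost' t := by
  simp [NoUnitGain, saleCost_κ]

/-- The positive factor `ybar - y` cancels and `z` enters only through the additive constant, so
testing with `y = z = 0` loses nothing. Every point lies in its order-connected component, which
makes the conditions pointwise, except for the one at right ends of purchasing regions. -/
lemma isEquilibriumLaw_iff {Ω : Type*} [MeasurableSpace Ω] {μ : Measure Ω} [IsProbabilityMeasure μ]
    (m : Model) (S : StochasticBasis Ω μ) (W P : Set ℝ) :
    m.IsEquilibriumLaw S W P ↔ m.IsUnitLaw W P := by
  have h0 : (0 : ℝ) ∈ Ico 0 m.ybar := ⟨le_rfl, m.ybar_pos⟩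
  obtain ⟨C, hC⟩ : ∃ C : ℝ → ℝ, ∀ z y, ∀ p : WithTop ℝ, y ∈ Ico 0 m.ybar →
      (p = ⊤ ∨ p = (m.T : WithTop ℝ)) →
      m.K S m.T y z p = C z + (m.ybar - y) * m.saleCost m.κ p := by
    choose C hC using fun z => m.exists_K_eq S le_rfl z
    exact ⟨C, fun z y p hy hp => hC z y p hy.2.le
      (hp.imp_right fun h => ⟨m.T, ⟨le_rfl, le_rfl⟩, h⟩)⟩
  have hKT : ∀ z, ∀ y ∈ Ico 0 m.ybar, m.K S m.T y z (m.T : ℝ) - m.K S m.T y z ⊤ =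
      (m.ybar - y) * m.unitCost m.T := fun z y hy => by
    rw [hC z y _ hy (Or.inr rfl), hC z y _ hy (Or.inl rfl), saleCost_κ, saleCost_top]
    ring
  have hKgap : ∀ t ≤ m.T, ∀ z, ∀ y ∈ Ico 0 m.ybar, ∀ p : WithTop ℝ,
      (p = ⊤ ∨ ∃ s ∈ Icc t m.T, p = (s : WithTop ℝ)) →
      (m.K S t y z (t : ℝ) ≤ m.K S t y z p ↔ m.unitCost t ≤ m.saleCost m.κ p) := by
    intro t ht z y hy p hp
    obtain ⟨C, hC⟩ := m.exists_K_eq S ht z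
    rw [hC y _ hy.2.le (Or.inr ⟨t, ⟨le_rfl, ht⟩, rfl⟩), hC y p hy.2.le hp, saleCost_κ,
      add_le_add_iff_left, mul_le_mul_iff_right₀ (sub_pos.2 hy.2)]
  constructor
  · intro H
    have hd := H.division
    refine ⟨hd, fun t ht htT => ?_, fun hT => ?_, fun t ht htT => ?_, fun I hI hTI t ht => ?_,
      fun hT => ?_⟩
    · rw [← m.noLocalGain_iff S htT h0.2 0 (hd.firstTime_Icc' t)]
      have hI := isSubRegion_ordConnectedComponent ht
      have htI := self_mem_ordConnectedComponent.2 ht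
      by_cases hT : m.T ∈ W.ordConnectedComponent t
      · exact (H.last_waiting _ hI hT 0 h0 0).1 t htI htT
      · exact H.sub_waiting _ hI hT t htI 0 h0 0
    · have := (H.last_waiting _ (isSubRegion_ordConnectedComponent hT)
        (self_mem_ordConnectedComponent.2 hT) 0 h0 0).2
      rw [hKT 0 0 h0] at this
      exact nonneg_of_mul_nonneg_right this (sub_pos.2 h0.2)
    · rw [← m.noUnitGain_self_iff, ← m.noLocalGain_iff S htT h0.2 0 (Or.inr ⟨t, ⟨le_rfl, htT.le⟩, rfl⟩)]
      have hI := isSubRegion_ordConnectedComponent ht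
      have htI := self_mem_ordConnectedComponent.2 ht
      by_cases hT : m.T ∈ P.ordConnectedComponent t
      · exact (H.last_purchasing _ hI hT 0 h0 0).1 t htI htT
      · exact (H.sub_purchasing _ hI hT 0 h0 0).1 t htI
    · have htT : t ≤ m.T := (hd.subset_right (hI.1.1 ht.1)).2
      exact (hKgap t htT 0 0 h0 _ (firstTime_Ioc P t m.T)).1
        ((H.sub_purchasing I hI hTI 0 h0 0).2 t ht)
    · have := (H.last_purchasing _ (isSubRegion_ordConnectedComponent hT)
        (self_mem_ordConnectedComponent.2 hT) 0 h0 0).2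
      rw [← sub_nonpos, hKT 0 0 h0] at this
      exact nonpos_of_mul_nonpos_right this (sub_pos.2 h0.2)
  · intro H
    have hd := H.division
    refine ⟨hd, fun I hI hTI t ht y hy z => ?_, fun I hI hTI y hy z => ⟨fun t ht htT => ?_, ?_⟩,
      fun I hI hTI y hy z => ⟨fun t ht => ?_, fun t ht => ?_⟩,
      fun I hI hTI y hy z => ⟨fun t ht htT => ?_, ?_⟩⟩
    · have htT : t < m.T := lt_of_le_of_ne (hd.subset_left (hI.1.1 ht)).2
        (by rintro rfl; exact hTI ht)
      exact (m.noLocalGain_iff S htT hy.2 z (hd.firstTime_Icc' t)).2 (H.waiting t (hI.1.1 ht) htT)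
    · exact (m.noLocalGain_iff S htT hy.2 z (hd.firstTime_Icc' t)).2 (H.waiting t (hI.1.1 ht) htT)
    · rw [hKT z y hy]
      exact mul_nonneg (sub_pos.2 hy.2).le (H.waiting_end (hI.1.1 hTI))
    · have htT : t < m.T := lt_of_le_of_ne (hd.subset_right (hI.1.1 ht)).2
        (by rintro rfl; exact hTI ht)
      exact (m.noLocalGain_iff S htT hy.2 z (Or.inr ⟨t, ⟨le_rfl, htT.le⟩, rfl⟩)).2
        ((m.noUnitGain_self_iff t).2 (H.purchasing t (hI.1.1 ht) htT))
    · have htT : t ≤ m.T := (hd.subset_right (hI.1.1 ht.1)).2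
      exact (hKgap t htT z y hy _ (firstTime_Ioc P t m.T)).2 (H.gap I hI hTI t ht)
    · exact (m.noLocalGain_iff S htT hy.2 z (Or.inr ⟨t, ⟨le_rfl, htT.le⟩, rfl⟩)).2
        ((m.noUnitGain_self_iff t).2 (H.purchasing t (hI.1.1 ht) htT))
    · rw [← sub_nonpos, hKT z y hy]
      exact mul_nonpos_of_nonneg_of_nonpos (sub_pos.2 hy.2).le (H.purchasing_end (hI.1.1 hTI))

end Model

/-! ### Sign and monotonicity of the unit cost -/

namespace Model

section UnitCost

variable (m : Model)

/-- Accumulated discount difference from `s` to the horizon. -/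
noncomputable def discount (s : ℝ) : ℝ := Real.exp (-m.d * (m.T - s))

lemma discount_T : m.discount m.T = 1 := by simp [discount]

lemma discount_zero : m.discount 0 = Real.exp (-m.T * m.d) := by
  simp [discount, mul_comm]

lemma discount_pos (s : ℝ) : 0 < m.discount s := Real.exp_pos _

lemma discount_le_discount_iff (hd : m.d < 0) {s u : ℝ} : m.discount s ≤ m.discount u ↔ u ≤ s := by
  rw [discount, discount, Real.exp_le_exp, mul_le_mul_iff_right₀ (by linarith : 0 < -m.d)]
  constructor <;> intro h <;> linarith

lemma discount_lt_discount_iff (hd : m.d < 0) {s u : ℝ} : m.discount s < m.discount u ↔ u < s := by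
  rw [← not_le, m.discount_le_discount_iff hd, not_le]

lemma discount_le_one (hd : 0 ≤ m.d) {s : ℝ} (hs : s ≤ m.T) : m.discount s ≤ 1 :=
  Real.exp_le_one_iff.2 (by nlinarith)

lemma discount_lt_one (hd : 0 < m.d) {s : ℝ} (hs : s < m.T) : m.discount s < 1 :=
  Real.exp_lt_one_iff.2 (by nlinarith)

/-- Factoring out the positive exponential leaves a comparison of `r` with the monotone function
`discount`; all later sign conditions rest on this and on the analogue for `unitCost'`. -/
lemma unitCost_eq (s : ℝ) : m.unitCost s =
    Real.exp (-m.bR * (m.T - s)) * (m.r - m.discount s) / m.r := by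
  have h : Real.exp (-(m.bR + m.d) * (m.T - s)) =
      Real.exp (-m.bR * (m.T - s)) * m.discount s := by
    rw [discount, ← Real.exp_add]; congr 1; ring
  have := m.r_pos.ne'
  rw [unitCost, h]
  field_simp

lemma unitCost'_eq (s : ℝ) : m.unitCost' s =
    Real.exp (-m.bR * (m.T - s)) * (m.bR * m.r - (m.bR + m.d) * m.discount s) / m.r := by
  have h : Real.exp (-(m.bR + m.d) * (m.T - s)) =
      Real.exp (-m.bR * (m.T - s)) * m.discount s := by
    rw [discount, ← Real.exp_add]; congr 1; ring
  have := m.r_pos.ne'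
  rw [unitCost', h]
  field_simp

lemma unitCost_T : m.unitCost m.T = (m.r - 1) / m.r := by
  rw [unitCost_eq, discount_T]; simp

lemma unitCost_pos_iff {s : ℝ} : 0 < m.unitCost s ↔ m.discount s < m.r := by
  rw [unitCost_eq, div_pos_iff_of_pos_right m.r_pos, mul_pos_iff_of_pos_left (Real.exp_pos _),
    sub_pos]

lemma unitCost_nonneg_iff {s : ℝ} : 0 ≤ m.unitCost s ↔ m.discount s ≤ m.r := by
  rw [unitCost_eq, le_div_iff₀ m.r_pos, zero_mul, mul_nonneg_iff_of_pos_left (Real.exp_pos _),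
    sub_nonneg]

lemma unitCost_nonpos_iff {s : ℝ} : m.unitCost s ≤ 0 ↔ m.r ≤ m.discount s := by
  rw [← not_lt, unitCost_pos_iff, not_lt]

lemma unitCost'_pos_iff {s : ℝ} :
    0 < m.unitCost' s ↔ (m.bR + m.d) * m.discount s < m.bR * m.r := by
  rw [unitCost'_eq, div_pos_iff_of_pos_right m.r_pos, mul_pos_iff_of_pos_left (Real.exp_pos _),
    sub_pos]

lemma unitCost'_nonneg_iff {s : ℝ} :
    0 ≤ m.unitCost' s ↔ (m.bR + m.d) * m.discount s ≤ m.bR * m.r := by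
  rw [unitCost'_eq, le_div_iff₀ m.r_pos, zero_mul, mul_nonneg_iff_of_pos_left (Real.exp_pos _),
    sub_nonneg]

lemma unitCost'_neg_iff {s : ℝ} :
    m.unitCost' s < 0 ↔ m.bR * m.r < (m.bR + m.d) * m.discount s := by
  rw [← not_le, unitCost'_nonneg_iff, not_le]

lemma continuous_unitCost : Continuous m.unitCost :=
  continuous_iff_continuousAt.2 fun s => (m.hasDerivAt_unitCost s).continuousAt

lemma continuous_unitCost' : Continuous m.unitCost' := by
  unfold unitCost'; fun_prop

lemma strictMonoOn_unitCost {α β : ℝ} (h : ∀ s ∈ Ioo α β, 0 < m.unitCost' s) :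
    StrictMonoOn m.unitCost (Icc α β) := by
  refine strictMonoOn_of_deriv_pos (convex_Icc α β) m.continuous_unitCost.continuousOn fun s hs => ?_
  rw [interior_Icc] at hs
  rw [(m.hasDerivAt_unitCost s).deriv]
  exact h s hs

lemma strictAntiOn_unitCost {α β : ℝ} (h : ∀ s ∈ Ioo α β, m.unitCost' s < 0) :
    StrictAntiOn m.unitCost (Icc α β) := by
  refine strictAntiOn_of_deriv_neg (convex_Icc α β) m.continuous_unitCost.continuousOn fun s hs => ?_
  rw [interior_Icc] at hs
  rw [(m.hasDerivAt_unitCost s).deriv]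
  exact h s hs

lemma noUnitGain_coe_iff {t p : ℝ} : m.NoUnitGain t (p : WithTop ℝ) ↔
    m.unitCost p < m.unitCost t ∨ (m.unitCost p = m.unitCost t ∧ 0 ≤ m.unitCost' t) := by
  rw [NoUnitGain, saleCost_κ]

lemma noUnitGain_top_iff {t : ℝ} : m.NoUnitGain t ⊤ ↔
    0 < m.unitCost t ∨ (0 = m.unitCost t ∧ 0 ≤ m.unitCost' t) := by
  rw [NoUnitGain, saleCost_top]

/-- So `cutoffTime` is the zero of `unitCost`. -/
lemma discount_cutoffTime (hd : m.d ≠ 0) : m.discount m.cutoffTime = m.r := by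
  have : -m.d * (m.T - m.cutoffTime) = Real.log m.r := by
    unfold cutoffTime; field_simp; ring
  rw [discount, this, Real.exp_log m.r_pos]

/-- So `startTime` is the critical point of `unitCost`; positivity of `bR + d` makes the argument of
the logarithm positive. -/
lemma discount_startTime (hd : m.d ≠ 0) (h : 0 < m.bR + m.d) :
    (m.bR + m.d) * m.discount m.startTime = m.bR * m.r := by
  have h1 : -m.d * (m.T - m.startTime) = Real.log (m.bR * m.r / (m.bR + m.d)) := by
    unfold startTime; field_simp; ring
  rw [discount, h1, Real.exp_log (div_pos (mul_pos m.bR_pos m.r_pos) h)]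
  field_simp

lemma one_add_div_mul_le_iff {x : ℝ} :
    (1 + m.d / m.bR) * x ≤ m.r ↔ (m.bR + m.d) * x ≤ m.bR * m.r := by
  have hb := m.bR_pos
  rw [← mul_le_mul_iff_right₀ hb]
  have : m.bR * ((1 + m.d / m.bR) * x) = (m.bR + m.d) * x := by field_simp
  rw [this]

lemma lt_one_add_div_mul_iff {x : ℝ} :
    m.r < (1 + m.d / m.bR) * x ↔ m.bR * m.r < (m.bR + m.d) * x := by
  rw [← not_le, one_add_div_mul_le_iff, not_le]

end UnitCost

/-! ### Structure forced on a law by the unit cost -/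

namespace IsUnitLaw

variable {m : Model} {W P : Set ℝ}

/-- The purchasing region of `t` ends at `t`, because a larger point would put part of the gap in
`P`; the gap condition then compares `t` with the next sale `q`. -/
lemma unitCost_le_of_next (H : m.IsUnitLaw W P) {t q : ℝ} (ht : t ∈ P) (hq : q ∈ P) (htq : t < q)
    (hgap : ∀ s ∈ Ioo t q, s ∉ P) : m.unitCost t ≤ m.unitCost q := by
  obtain ⟨u, hu⟩ := exists_between htq
  have hq' := H.division.subset_right hq
  have hI := isSubRegion_ordConnectedComponent ht
  have hle : ∀ s ∈ P.ordConnectedComponent t, s ≤ t := fun s hs => by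
    by_contra! hts
    refine hgap (min s u) ⟨lt_min hts hu.1, (min_le_right _ _).trans_lt hu.2⟩
      (mem_ordConnectedComponent.1 hs ?_)
    rw [uIcc_of_le hts.le]
    exact ⟨(lt_min hts hu.1).le, min_le_left _ _⟩
  have := H.gap _ hI (fun h => absurd (hle _ h) (not_le.2 (htq.trans_le hq'.2))) t
    ⟨self_mem_ordConnectedComponent.2 ht, hle⟩
  rwa [firstTime_eq_coe (A := P ∩ Ioc t m.T) (s := q) ⟨⟨hq, htq, hq'.2⟩, fun s hs =>
    not_lt.1 fun hsq => hgap s ⟨hs.2.1, hsq⟩ hs.1⟩, saleCost_κ] at this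

/-- After the last purchasing time the alternative is never to sell, at cost zero. If that time is
the horizon, the end condition says the same. -/
lemma unitCost_nonpos_of_isGreatest (H : m.IsUnitLaw W P) {t : ℝ} (ht : IsGreatest P t) :
    m.unitCost t ≤ 0 := by
  have ht' := H.division.subset_right ht.1
  rcases ht'.2.eq_or_lt with rfl | htT
  · exact H.purchasing_end ht.1
  have := H.gap _ (isSubRegion_ordConnectedComponent ht.1)
    (fun h => absurd (ht.2 (ordConnectedComponent_subset h)) (not_le.2 htT)) t
    ⟨self_mem_ordConnectedComponent.2 ht.1, fun s hs => ht.2 (ordConnectedComponent_subset hs)⟩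
  rwa [show P ∩ Ioc t m.T = ∅ from eq_empty_of_forall_notMem fun s hs =>
    absurd (ht.2 hs.1) (not_le.2 hs.2.1), firstTime_empty, saleCost_top] at this

lemma exists_isGreatest (H : m.IsUnitLaw W P) (hP : P.Nonempty) : ∃ t, IsGreatest P t :=
  ⟨_, H.division.2.2.isGreatest_csSup hP ⟨m.T, fun _ hs => (H.division.subset_right hs).2⟩⟩

lemma unitCost_nonneg_of_after (H : m.IsUnitLaw W P) {t : ℝ} (ht : t ∈ Ico 0 m.T)
    (h : ∀ s ∈ P, s < t) : 0 ≤ m.unitCost t := by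
  have := H.waiting t (H.division.mem_left ⟨ht.1, ht.2.le⟩ fun hP => lt_irrefl _ (h t hP)) ht.2
  rw [show P ∩ Icc t m.T = ∅ from eq_empty_of_forall_notMem fun s hs =>
    absurd (h s hs.1) (not_lt.2 hs.2.1), firstTime_empty, noUnitGain_top_iff] at this
  rcases this with h | h
  · exact h.le
  · exact h.1.le

/-- Where the cost increases strictly, waiting at `t` for the next sale, which comes no later than
`β`, is strictly dearer than selling at `t`. -/
lemma Icc_subset_of_strictMonoOn (H : m.IsUnitLaw W P) {α β : ℝ} (hα : 0 ≤ α) (hβ : β ∈ P)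
    (hmono : StrictMonoOn m.unitCost (Icc α β)) : Icc α β ⊆ P := by
  intro t ht
  by_contra htP
  have hβT := (H.division.subset_right hβ).2
  have htβ : t < β := lt_of_le_of_ne ht.2 (by rintro rfl; exact htP hβ)
  have hw := H.waiting t (H.division.mem_left ⟨hα.trans ht.1, htβ.le.trans hβT⟩ htP)
    (htβ.trans_le hβT)
  rcases H.division.firstTime_Icc t with h | ⟨s, hs, h⟩
  · exact (h.1 ▸ (⟨hβ, htβ.le, hβT⟩ : β ∈ P ∩ Icc t m.T) : β ∈ (∅ : Set ℝ))
  · have hts : t < s := lt_of_le_of_ne hs.1.2.1 (by rintro rfl; exact htP hs.1.1)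
    have := hmono ht ⟨ht.1.trans hts.le, hs.2 ⟨hβ, htβ.le, hβT⟩⟩ hts
    rw [h, noUnitGain_coe_iff] at hw
    rcases hw with h | h
    · linarith
    · linarith [h.1]

/-- If the unit cost is positive before the horizon, and the horizon is a waiting time, nothing
is sold. -/
lemma eq_empty_of_pos (H : m.IsUnitLaw W P) (hpos : ∀ t ∈ Ico 0 m.T, 0 < m.unitCost t)
    (hT : m.T ∉ P) : P = ∅ := by
  by_contra hne
  obtain ⟨t, ht⟩ := H.exists_isGreatest (nonempty_iff_ne_empty.2 hne)
  have ht' := H.division.subset_right ht.1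
  have := hpos t ⟨ht'.1, lt_of_le_of_ne ht'.2 (by rintro rfl; exact hT ht.1)⟩
  linarith [H.unitCost_nonpos_of_isGreatest ht]

/-- If the horizon is a purchasing time, the unit cost is strictly lowest at the horizon and
decreases there, then everything is sold at the horizon. -/
lemma eq_singleton (H : m.IsUnitLaw W P) (hT : m.T ∈ P)
    (hlow : ∀ t ∈ Ico 0 m.T, m.unitCost m.T < m.unitCost t) (hneg : m.unitCost' m.T < 0) :
    P = {m.T} := by
  refine Subset.antisymm (fun s hs => ?_) (singleton_subset_iff.2 hT)
  by_contra hsT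
  have hs' := H.division.subset_right hs
  have hsT : s < m.T := lt_of_le_of_ne hs'.2 hsT
  -- A negative derivative near the horizon excludes purchasing times in `(l, T)`. By closedness
  -- there is then a last one before `T`, and the gap from it to `T` contradicts `hlow`.
  obtain ⟨l, hl, hlT⟩ := exists_Ioc_subset_of_mem_nhds
    (m.continuous_unitCost'.continuousAt.eventually (gt_mem_nhds hneg)) ⟨s, hsT⟩
  have hbound : ∀ u ∈ P, u < m.T → u ≤ l := fun u hu huT => by
    by_contra! hlu
    exact absurd (H.purchasing u hu huT) (not_le.2 (hlT ⟨hlu, huT.le⟩))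
  obtain ⟨t, ht⟩ : ∃ t, IsGreatest (P ∩ Iic l) t :=
    ⟨_, (H.division.2.2.inter isClosed_Iic).isGreatest_csSup ⟨s, hs, hbound s hs hsT⟩
      ⟨l, fun _ hs => hs.2⟩⟩
  have htT : t < m.T := lt_of_le_of_lt ht.1.2 hl
  have := H.unitCost_le_of_next ht.1.1 hT htT fun u hu huP =>
    absurd (ht.2 ⟨huP, hbound u huP hu.2⟩) (not_le.2 hu.1)
  linarith [hlow t ⟨(H.division.subset_right ht.1.1).1, htT⟩]

end IsUnitLaw

/-! ### Classification by parameter region -/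

variable (m : Model)

lemma isDivision_Icc {T α β : ℝ} {W : Set ℝ} (hα : 0 ≤ α) (hβ : β ≤ T)
    (hW : W = Icc 0 T \ Icc α β) : IsDivision T W (Icc α β) := by
  refine ⟨?_, ?_, isClosed_Icc⟩
  · rw [hW, sdiff_union_self, union_eq_left.2 (Icc_subset_Icc hα hβ)]
  · rw [hW]; exact disjoint_sdiff_left

/-- An interval has a single right end, followed by no sale, so both the gap condition and the end
condition reduce to `unitCost β ≤ 0`. -/
lemma isUnitLaw_Icc {α β : ℝ} {W : Set ℝ} (hα : 0 ≤ α) (hαβ : α ≤ β) (hβ : β ≤ m.T)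
    (hW : W = Icc 0 m.T \ Icc α β) (hbefore : ∀ t ∈ Ico 0 α, m.NoUnitGain t (α : WithTop ℝ))
    (hafter : ∀ t ∈ Ioo β m.T, 0 < m.unitCost t)
    (hbetween : ∀ t ∈ Icc α β, t < m.T → 0 ≤ m.unitCost' t)
    (hend : m.unitCost β ≤ 0) (hT : β < m.T → 0 ≤ m.unitCost m.T) :
    m.IsUnitLaw W (Icc α β) := by
  refine ⟨isDivision_Icc hα hβ hW, fun t ht htT => ?_, fun h => ?_, fun t ht htT => hbetween t ht htT,
    fun I hI hTI t ht => ?_, fun h => ?_⟩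
  · rw [hW] at ht
    rcases lt_or_ge t α with h | h
    · rw [firstTime_eq_coe (A := Icc α β ∩ Icc t m.T) (s := α) ⟨⟨left_mem_Icc.2 hαβ, h.le, hαβ.trans hβ⟩, fun s hs => hs.1.1⟩]
      exact hbefore t ⟨ht.1.1, h⟩
    · have hβt : β < t := not_le.1 fun h' => ht.2 ⟨h, h'⟩
      rw [show Icc α β ∩ Icc t m.T = ∅ from eq_empty_of_forall_notMem fun s hs =>
        absurd (hs.1.2.trans_lt hβt) (not_lt.2 hs.2.1), firstTime_empty, noUnitGain_top_iff]
      exact Or.inl (hafter t ⟨hβt, htT⟩)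
  · rw [hW] at h
    exact hT (not_le.1 fun h' => h.2 ⟨hαβ.trans hβ, h'⟩)
  · rw [hI.eq_of_ordConnected ordConnected_Icc] at ht
    rw [ht.unique (isGreatest_Icc hαβ), show Icc α β ∩ Ioc β m.T = ∅ from
      eq_empty_of_forall_notMem fun s hs => absurd hs.1.2 (not_le.2 hs.2.1), firstTime_empty]
    exact hend
  · rwa [hβ.antisymm h.2] at hend

lemma isUnitLaw_empty (h : ∀ t ∈ Ico 0 m.T, m.NoUnitGain t ⊤) (hT : 0 ≤ m.unitCost m.T) :
    m.IsUnitLaw (Icc 0 m.T) ∅ := by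
  refine ⟨⟨union_empty _, disjoint_bot_right, isClosed_empty⟩, fun t ht htT => ?_, fun _ => hT,
    fun t ht => absurd ht (notMem_empty t), fun I hI _ t ht => absurd (hI.1.1 ht.1) (notMem_empty t),
    fun h => absurd h (notMem_empty _)⟩
  rw [empty_inter, firstTime_empty]
  exact h t ⟨ht.1, htT⟩

lemma IsUnitLaw.eq_and_eq_of_right {m : Model} {W P W' P' : Set ℝ} (H : m.IsUnitLaw W P)
    (hP : P = P') (hW : Icc 0 m.T \ P' = W') : W = W' ∧ P = P' :=
  ⟨by rw [H.division.left_eq, hP, hW], hP⟩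

/-- `discount` is monotone, so on `[0, T]` it is bounded by its endpoint values, both below `r`:
every sale has positive cost. -/
lemma isUnitLaw_iff_regionI (h : (m.d, m.r) ∈ m.regionI) (W P : Set ℝ) :
    m.IsUnitLaw W P ↔ W = Icc 0 m.T ∧ P = ∅ := by
  obtain ⟨h1, h2⟩ : 1 < m.r ∧ Real.exp (-m.T * m.d) < m.r := h
  rw [← discount_zero] at h2
  have hpos : ∀ t ∈ Icc 0 m.T, 0 < m.unitCost t := fun t ht => by
    rw [unitCost_pos_iff]
    rcases lt_or_ge m.d 0 with hd | hd
    · exact ((m.discount_le_discount_iff hd).2 ht.1).trans_lt h2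
    · exact (m.discount_le_one hd ht.2).trans_lt h1
  have hT := hpos m.T ⟨m.T_pos.le, le_rfl⟩
  constructor
  · intro H
    exact H.eq_and_eq_of_right (H.eq_empty_of_pos (fun t ht => hpos t ⟨ht.1, ht.2.le⟩)
      fun h => absurd (H.purchasing_end h) (not_le.2 hT)) sdiff_empty
  · rintro ⟨rfl, rfl⟩
    exact m.isUnitLaw_empty (fun t ht => m.noUnitGain_top_iff.2 (Or.inl (hpos t ⟨ht.1, ht.2.le⟩)))
      hT.le

lemma cutoffTime_mem (hd : m.d < 0) (h1 : 1 < m.r) (h2 : m.r ≤ m.discount 0) :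
    m.cutoffTime ∈ Ico 0 m.T := by
  constructor
  · rwa [← m.discount_le_discount_iff hd, m.discount_cutoffTime hd.ne]
  · rwa [← m.discount_lt_discount_iff hd, m.discount_cutoffTime hd.ne, discount_T]

lemma unitCost_pos_iff_cutoffTime_lt (hd : m.d < 0) {s : ℝ} :
    0 < m.unitCost s ↔ m.cutoffTime < s := by
  rw [unitCost_pos_iff, ← m.discount_cutoffTime hd.ne, m.discount_lt_discount_iff hd]

lemma unitCost'_nonneg_iff_startTime_le (hd : m.d < 0) (h : 0 < m.bR + m.d) {s : ℝ} :
    0 ≤ m.unitCost' s ↔ m.startTime ≤ s := by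
  rw [unitCost'_nonneg_iff, ← m.discount_startTime hd.ne h, mul_le_mul_iff_right₀ h,
    m.discount_le_discount_iff hd]

lemma unitCost'_pos_iff_startTime_lt (hd : m.d < 0) (h : 0 < m.bR + m.d) {s : ℝ} :
    0 < m.unitCost' s ↔ m.startTime < s := by
  rw [unitCost'_pos_iff, ← m.discount_startTime hd.ne h, mul_lt_mul_iff_right₀ h,
    m.discount_lt_discount_iff hd]

/-- The hypothesis says that the derivative is nonnegative at time `0`. If `bR + d > 0`, the strict
decrease of `discount` propagates this; otherwise positivity is immediate. -/
lemma unitCost'_pos_of_le (hd : m.d < 0)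
    (h : (1 + m.d / m.bR) * Real.exp (-m.T * m.d) ≤ m.r) {s : ℝ} (hs : 0 < s) :
    0 < m.unitCost' s := by
  rw [one_add_div_mul_le_iff, ← discount_zero] at h
  rw [unitCost'_pos_iff]
  rcases lt_or_ge 0 (m.bR + m.d) with hb | hb
  · exact ((mul_lt_mul_iff_right₀ hb).2 ((m.discount_lt_discount_iff hd).2 hs)).trans_le h
  · exact (mul_nonpos_of_nonpos_of_nonneg hb (m.discount_pos s).le).trans_lt
      (mul_pos m.bR_pos m.r_pos)

lemma unitCost'_nonneg_of_le (hd : m.d < 0)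
    (h : (1 + m.d / m.bR) * Real.exp (-m.T * m.d) ≤ m.r) {s : ℝ} (hs : 0 ≤ s) :
    0 ≤ m.unitCost' s := by
  rcases hs.eq_or_lt with rfl | hs
  · rwa [one_add_div_mul_le_iff, ← discount_zero, ← unitCost'_nonneg_iff] at h
  · exact (m.unitCost'_pos_of_le hd h hs).le

/-- The last sale cannot have positive cost, so it is not after the cutoff. Were it earlier, sales
of negative cost would be forgone in between. -/
lemma IsUnitLaw.isGreatest_cutoffTime {m : Model} {W P : Set ℝ} (H : m.IsUnitLaw W P)
    (hd : m.d < 0) (h1 : 1 < m.r) (h2 : m.r ≤ m.discount 0) (hP : P.Nonempty) :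
    IsGreatest P m.cutoffTime := by
  obtain ⟨t, ht⟩ := H.exists_isGreatest hP
  have hc := m.cutoffTime_mem hd h1 h2
  have hle : t ≤ m.cutoffTime := by
    rw [← not_lt, ← m.unitCost_pos_iff_cutoffTime_lt hd, not_lt]
    exact H.unitCost_nonpos_of_isGreatest ht
  rcases hle.eq_or_lt with rfl | hlt
  · exact ht
  exfalso
  obtain ⟨s, hs⟩ := exists_between hlt
  have h3 := H.unitCost_nonneg_of_after
    ⟨((H.division.subset_right ht.1).1.trans hs.1.le), hs.2.trans hc.2⟩
    fun u hu => (ht.2 hu).trans_lt hs.1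
  rw [unitCost_nonneg_iff, ← m.discount_cutoffTime hd.ne, m.discount_le_discount_iff hd] at h3
  exact absurd hs.2 (not_lt.2 h3)

lemma neg_of_one_lt_exp (h : 1 < Real.exp (-m.T * m.d)) : m.d < 0 := by
  rw [Real.one_lt_exp_iff] at h
  nlinarith [m.T_pos]

/-- The cost increases on `[0, T]` through its zero at the cutoff. Never selling requires
nonnegative cost already at time `0`, which happens only when the cutoff is `0`. -/
lemma isUnitLaw_iff_regionII (h : (m.d, m.r) ∈ m.regionII) (W P : Set ℝ) :
    m.IsUnitLaw W P ↔ (W = Ioc m.cutoffTime m.T ∧ P = Icc 0 m.cutoffTime) ∨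
        (m.r = Real.exp (-m.T * m.d) ∧ W = Icc 0 m.T ∧ P = ∅) := by
  obtain ⟨h1, h2, h3⟩ : 1 < m.r ∧ m.r ≤ Real.exp (-m.T * m.d) ∧
    (1 + m.d / m.bR) * Real.exp (-m.T * m.d) ≤ m.r := h
  have hd := m.neg_of_one_lt_exp (h1.trans_le h2)
  have h2' := h2
  rw [← discount_zero] at h2
  have hc := m.cutoffTime_mem hd h1 h2
  have hdiff : Icc 0 m.T \ Icc 0 m.cutoffTime = Ioc m.cutoffTime m.T := by
    ext s
    simp only [Set.mem_sdiff, mem_Icc, mem_Ioc, not_and, not_le]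
    exact ⟨fun h => ⟨h.2 h.1.1, h.1.2⟩, fun h => ⟨⟨hc.1.trans h.1.le, h.2⟩, fun _ => h.1⟩⟩
  have hT : 0 < m.unitCost m.T := (m.unitCost_pos_iff_cutoffTime_lt hd).2 hc.2
  constructor
  · intro H
    rcases P.eq_empty_or_nonempty with hP | hP
    · refine Or.inr ⟨le_antisymm h2' ?_, H.eq_and_eq_of_right hP sdiff_empty⟩
      have := H.unitCost_nonneg_of_after (t := 0) ⟨le_rfl, m.T_pos⟩ (by simp [hP])
      rwa [unitCost_nonneg_iff, discount_zero] at this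
    · have hg := H.isGreatest_cutoffTime hd h1 h2 hP
      refine Or.inl (H.eq_and_eq_of_right (Subset.antisymm (fun s hs =>
        ⟨(H.division.subset_right hs).1, hg.2 hs⟩) (H.Icc_subset_of_strictMonoOn le_rfl hg.1
          (m.strictMonoOn_unitCost fun s hs => m.unitCost'_pos_of_le hd h3 hs.1))) hdiff)
  · rintro (⟨rfl, rfl⟩ | ⟨hr, rfl, rfl⟩)
    · refine m.isUnitLaw_Icc le_rfl hc.1 hc.2.le hdiff.symm (fun t ht => absurd ht.1 (not_le.2 ht.2))
        (fun t ht => (m.unitCost_pos_iff_cutoffTime_lt hd).2 ht.1)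
        (fun t ht _ => m.unitCost'_nonneg_of_le hd h3 ht.1) ?_ (fun _ => hT.le)
      rw [← not_lt, m.unitCost_pos_iff_cutoffTime_lt hd]
      exact lt_irrefl _
    · refine m.isUnitLaw_empty (fun t ht => m.noUnitGain_top_iff.2 ?_) hT.le
      have : 0 ≤ m.unitCost t := by
        rw [unitCost_nonneg_iff, hr, ← discount_zero, m.discount_le_discount_iff hd]
        exact ht.1
      exact this.lt_or_eq.imp_right fun h => ⟨h, m.unitCost'_nonneg_of_le hd h3 ht.1⟩

/-- If the horizon were a waiting time, closedness of `P` would leave a final interval without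
sales. The cost there is strictly below `unitCost T ≤ 0`, so forgoing the sale is not optimal. -/
lemma IsUnitLaw.T_mem {m : Model} {W P : Set ℝ} (H : m.IsUnitLaw W P) (hr : m.r ≤ 1) {α : ℝ}
    (hα : 0 ≤ α) (hαT : α < m.T) (hmono : StrictMonoOn m.unitCost (Icc α m.T)) : m.T ∈ P := by
  by_contra hTP
  have hTle : m.unitCost m.T ≤ 0 := by rwa [unitCost_nonpos_iff, discount_T]
  have hneg : ∀ t ∈ Ico α m.T, m.unitCost t < 0 := fun t ht =>
    (hmono ⟨ht.1, ht.2.le⟩ (right_mem_Icc.2 hαT.le) ht.2).trans_le hTle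
  obtain ⟨l, hl, hlP⟩ := exists_Ioc_subset_of_mem_nhds
    (H.division.2.2.isOpen_compl.mem_nhds hTP) ⟨α, hαT⟩
  obtain ⟨s, hs⟩ := exists_between (max_lt hl hαT)
  have hs1 := (le_max_right _ _).trans hs.1.le
  have := H.unitCost_nonneg_of_after (t := s) ⟨hα.trans hs1, hs.2⟩ fun u hu => by
    by_contra! hsu
    exact hlP ⟨((le_max_left _ _).trans_lt hs.1).trans_le hsu, (H.division.subset_right hu).2⟩ hu
  linarith [hneg s ⟨hs1, hs.2⟩]

lemma isUnitLaw_iff_regionIII (h : (m.d, m.r) ∈ m.regionIII) (W P : Set ℝ) :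
    m.IsUnitLaw W P ↔ W = ∅ ∧ P = Icc 0 m.T := by
  obtain ⟨h1, h2, hd⟩ : m.r ≤ 1 ∧ (1 + m.d / m.bR) * Real.exp (-m.T * m.d) ≤ m.r ∧ m.d < 0 := h
  have hmono : StrictMonoOn m.unitCost (Icc 0 m.T) :=
    m.strictMonoOn_unitCost fun s hs => m.unitCost'_pos_of_le hd h2 hs.1
  constructor
  · intro H
    exact H.eq_and_eq_of_right (Subset.antisymm H.division.subset_right
      (H.Icc_subset_of_strictMonoOn le_rfl (H.T_mem h1 le_rfl m.T_pos hmono) hmono)) Set.sdiff_self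
  · rintro ⟨rfl, rfl⟩
    refine m.isUnitLaw_Icc le_rfl m.T_pos.le le_rfl Set.sdiff_self.symm
      (fun t ht => absurd ht.1 (not_le.2 ht.2)) (fun t ht => absurd ht.1 (not_lt.2 ht.2.le))
      (fun t ht _ => m.unitCost'_nonneg_of_le hd h2 ht.1) ?_ (fun h => absurd h (lt_irrefl _))
    rwa [unitCost_nonpos_iff, discount_T]

lemma Icc_sdiff_Icc_left {T α : ℝ} (hα : α ≤ T) : Icc 0 T \ Icc α T = Ico 0 α := by
  ext s
  simp only [Set.mem_sdiff, mem_Icc, mem_Ico, not_and, not_le]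
  refine ⟨fun h => ⟨h.1.1, not_le.1 fun h' => absurd h.1.2 (not_le.2 (h.2 h'))⟩,
    fun h => ⟨⟨h.1, h.2.le.trans hα⟩, fun h' => absurd h.2 (not_lt.2 h')⟩⟩

lemma isUnitLaw_iff_regionIV (h : (m.d, m.r) ∈ m.regionIV) (W P : Set ℝ) :
    m.IsUnitLaw W P ↔ W = Ico 0 m.startTime ∧ P = Icc m.startTime m.T := by
  obtain ⟨h1, h2, h3⟩ : m.r ≤ 1 ∧ m.r < (1 + m.d / m.bR) * Real.exp (-m.T * m.d) ∧
    1 + m.d / m.bR ≤ m.r := h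
  have h4 := h3
  rw [← mul_one (1 + m.d / m.bR), one_add_div_mul_le_iff, mul_one] at h4
  have hpos : 0 < 1 + m.d / m.bR :=
    pos_of_mul_pos_left (m.r_pos.trans h2) (Real.exp_pos _).le
  have hb : 0 < m.bR + m.d := by
    have := mul_pos m.bR_pos hpos
    have hne := m.bR_pos.ne'
    field_simp at this
    exact this
  have hd : m.d < 0 := by
    refine m.neg_of_one_lt_exp ?_
    by_contra! hle
    have := mul_le_mul_of_nonneg_left hle hpos.le
    linarith
  rw [lt_one_add_div_mul_iff, ← discount_zero, ← m.discount_startTime hd.ne hb,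
    mul_lt_mul_iff_right₀ hb, m.discount_lt_discount_iff hd] at h2
  have hsT : m.startTime ≤ m.T := by
    rwa [← m.unitCost'_nonneg_iff_startTime_le hd hb, unitCost'_nonneg_iff, discount_T, mul_one]
  have hmono : StrictMonoOn m.unitCost (Icc m.startTime m.T) :=
    m.strictMonoOn_unitCost fun s hs => (m.unitCost'_pos_iff_startTime_lt hd hb).2 hs.1
  have hanti : StrictAntiOn m.unitCost (Icc 0 m.startTime) :=
    m.strictAntiOn_unitCost fun s hs => by
      rw [← not_le, m.unitCost'_nonneg_iff_startTime_le hd hb, not_le]; exact hs.2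
  constructor
  · intro H
    have hTP : m.T ∈ P := by
      -- When `startTime = T` there is no increasing stretch to use. Waiting at `T` would then force
      -- `r = 1`, and the equation defining `startTime` would give `d = 0`.
      rcases hsT.eq_or_lt with heq | hlt
      · by_contra hTP
        have := H.waiting_end (H.division.mem_left ⟨m.T_pos.le, le_rfl⟩ hTP)
        rw [unitCost_nonneg_iff, discount_T] at this
        have hst := m.discount_startTime hd.ne hb
        rw [heq, discount_T, le_antisymm h1 this] at hst
        linarith
      · exact H.T_mem h1 h2.le hlt hmono
    refine H.eq_and_eq_of_right (Subset.antisymm (fun s hs => ?_)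
      (H.Icc_subset_of_strictMonoOn h2.le hTP hmono)) (Icc_sdiff_Icc_left hsT)
    have hs' := H.division.subset_right hs
    refine ⟨?_, hs'.2⟩
    rcases hs'.2.eq_or_lt with rfl | hlt
    · exact hsT
    · exact (m.unitCost'_nonneg_iff_startTime_le hd hb).1 (H.purchasing s hs hlt)
  · rintro ⟨rfl, rfl⟩
    refine m.isUnitLaw_Icc h2.le hsT le_rfl (Icc_sdiff_Icc_left hsT).symm
      (fun t ht => m.noUnitGain_coe_iff.2 (Or.inl (hanti ⟨ht.1, ht.2.le⟩ (right_mem_Icc.2 h2.le) ht.2)))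
      (fun t ht => absurd ht.1 (not_lt.2 ht.2.le))
      (fun t ht _ => (m.unitCost'_nonneg_iff_startTime_le hd hb).2 ht.1) ?_
      (fun h => absurd h (lt_irrefl _))
    rwa [unitCost_nonpos_iff, discount_T]

lemma isUnitLaw_singleton (hlow : ∀ t ∈ Ico 0 m.T, m.unitCost m.T < m.unitCost t)
    (hr : m.r ≤ 1) : m.IsUnitLaw (Ico 0 m.T) {m.T} := by
  rw [← Icc_self]
  exact m.isUnitLaw_Icc m.T_pos.le le_rfl le_rfl (Icc_sdiff_Icc_left le_rfl).symm
    (fun t ht => m.noUnitGain_coe_iff.2 (Or.inl (hlow t ht)))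
    (fun t ht => absurd ht.1 (not_lt.2 ht.2.le))
    (fun t ht htT => absurd ht.1 (not_le.2 htT))
    (by rwa [unitCost_nonpos_iff, discount_T]) (fun h => absurd h (lt_irrefl _))

lemma Icc_sdiff_singleton_right : Icc 0 m.T \ {m.T} = Ico 0 m.T := by
  rw [← Icc_self, Icc_sdiff_Icc_left le_rfl]

lemma isUnitLaw_iff_regionV (h : (m.d, m.r) ∈ m.regionV) (W P : Set ℝ) :
    m.IsUnitLaw W P ↔ W = Ico 0 m.T ∧ P = {m.T} := by
  obtain ⟨h1, h2⟩ : m.r < 1 + m.d / m.bR ∧ m.r < 1 := h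
  rw [← mul_one (1 + m.d / m.bR), lt_one_add_div_mul_iff, mul_one] at h1
  have hneg : m.unitCost' m.T < 0 := by rwa [unitCost'_neg_iff, discount_T, mul_one]
  have hTneg : m.unitCost m.T < 0 := by
    rw [← not_le, unitCost_nonneg_iff, discount_T, not_le]; exact h2
  have hlow : ∀ t ∈ Ico 0 m.T, m.unitCost m.T < m.unitCost t := fun t ht => by
    rcases lt_or_ge m.d 0 with hd | hd
    · have hanti : StrictAntiOn m.unitCost (Icc 0 m.T) :=
        m.strictAntiOn_unitCost fun s hs => by
          rw [unitCost'_neg_iff]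
          have hb : 0 < m.bR + m.d := (mul_pos m.bR_pos m.r_pos).trans h1
          have h3 : 1 < m.discount s := by
            rw [← discount_T, m.discount_lt_discount_iff hd]; exact hs.2
          exact h1.trans (lt_mul_of_one_lt_right hb h3)
      exact hanti ⟨ht.1, ht.2.le⟩ ⟨m.T_pos.le, le_rfl⟩ ht.2
    -- For `d ≥ 0` the cost need not be monotone, but `r - discount t ≥ r - 1`, and the negative
    -- number `r - 1` grows when multiplied by a factor below one.
    · have hE : Real.exp (-m.bR * (m.T - t)) < 1 :=
        Real.exp_lt_one_iff.2 (by nlinarith [m.bR_pos, ht.2])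
      have h3 := m.discount_le_one hd ht.2.le
      rw [unitCost_T, unitCost_eq]
      refine div_lt_div_of_pos_right ?_ m.r_pos
      have h4 := mul_le_mul_of_nonneg_left (sub_le_sub_left h3 m.r)
        (Real.exp_pos (-m.bR * (m.T - t))).le
      nlinarith
  constructor
  · intro H
    have hTP : m.T ∈ P := by
      by_contra hTP
      exact absurd (H.waiting_end (H.division.mem_left ⟨m.T_pos.le, le_rfl⟩ hTP)) (not_le.2 hTneg)
    exact H.eq_and_eq_of_right (H.eq_singleton hTP hlow hneg) m.Icc_sdiff_singleton_right
  · rintro ⟨rfl, rfl⟩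
    exact m.isUnitLaw_singleton hlow h2.le

/-- The cost is positive before the horizon and zero there, so selling at `T` and never selling are
equivalent, and no earlier sale is compatible with either. -/
lemma isUnitLaw_iff_regionVI (h : (m.d, m.r) ∈ regionVI) (W P : Set ℝ) :
    m.IsUnitLaw W P ↔ (W = Ico 0 m.T ∧ P = {m.T}) ∨ (W = Icc 0 m.T ∧ P = ∅) := by
  obtain ⟨hr, hd⟩ : m.r = 1 ∧ 0 < m.d := h
  have hT : m.unitCost m.T = 0 := by rw [unitCost_T, hr]; simp
  have hpos : ∀ t ∈ Ico 0 m.T, 0 < m.unitCost t := fun t ht => by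
    rw [unitCost_pos_iff, hr]; exact m.discount_lt_one hd ht.2
  constructor
  · intro H
    by_cases hTP : m.T ∈ P
    · refine Or.inl (H.eq_and_eq_of_right (H.eq_singleton hTP (by rwa [hT]) ?_)
        m.Icc_sdiff_singleton_right)
      rw [unitCost'_neg_iff, discount_T, hr]
      linarith
    · exact Or.inr (H.eq_and_eq_of_right (H.eq_empty_of_pos hpos hTP) sdiff_empty)
  · rintro (⟨rfl, rfl⟩ | ⟨rfl, rfl⟩)
    · exact m.isUnitLaw_singleton (by rwa [hT]) hr.le
    · exact m.isUnitLaw_empty (fun t ht => m.noUnitGain_top_iff.2 (Or.inl (hpos t ht))) hT.ge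

lemma unitCost_eq_zero_of_regionVII (h : (m.d, m.r) ∈ regionVII) (s : ℝ) :
    m.unitCost s = 0 ∧ m.unitCost' s = 0 := by
  obtain ⟨hd, hr⟩ : m.d = 0 ∧ m.r = 1 := Prod.mk.inj h
  constructor
  · rw [unitCost_eq, discount, hd, hr]; simp
  · rw [unitCost'_eq, discount, hd, hr]; simp

lemma isUnitLaw_iff_regionVII (h : (m.d, m.r) ∈ regionVII) (W P : Set ℝ) :
    m.IsUnitLaw W P ↔ IsDivision m.T W P := by
  refine ⟨fun H => H.division, fun H => ?_⟩
  have h0 := fun s => (m.unitCost_eq_zero_of_regionVII h s).1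
  have h0' := fun s => (m.unitCost_eq_zero_of_regionVII h s).2
  have hs : ∀ p : WithTop ℝ, m.saleCost m.κ p = 0 := fun p => by
    induction p using WithTop.recTopCoe with
    | top => rfl
    | coe p => rw [saleCost_κ, h0]
  exact ⟨H, fun t _ _ => Or.inr (by simp [h0, h0', hs]), fun _ => (h0 _).ge, fun _ _ _ => (h0' _).ge,
    fun _ _ _ _ _ => by simp [h0, hs], fun _ => (h0 _).le⟩

/-- The cost starts negative, falls until `startTime`, then rises through zero at the cutoff before
the horizon: the start is a first-order condition, the end a comparison with never selling. -/
lemma isUnitLaw_iff_regionVIII (h : (m.d, m.r) ∈ m.regionVIII) (W P : Set ℝ) :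
    m.IsUnitLaw W P ↔ W = Ico 0 m.startTime ∪ Ioc m.cutoffTime m.T ∧
        P = Icc m.startTime m.cutoffTime := by
  obtain ⟨h1, h2, hd⟩ : 1 < m.r ∧ m.r < (1 + m.d / m.bR) * Real.exp (-m.T * m.d) ∧ m.d < 0 := h
  rw [lt_one_add_div_mul_iff, ← discount_zero] at h2
  have hb : 0 < m.bR + m.d :=
    pos_of_mul_pos_left ((mul_pos m.bR_pos m.r_pos).trans h2) (m.discount_pos 0).le
  rw [← m.discount_startTime hd.ne hb, mul_lt_mul_iff_right₀ hb,
    m.discount_lt_discount_iff hd] at h2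
  have hsc : m.startTime < m.cutoffTime := by
    rw [← m.unitCost'_pos_iff_startTime_lt hd hb, unitCost'_pos_iff, m.discount_cutoffTime hd.ne]
    exact mul_lt_mul_of_pos_right (by linarith) m.r_pos
  have hr0 : m.r < m.discount 0 := by
    rw [← m.discount_cutoffTime hd.ne, m.discount_lt_discount_iff hd]
    exact h2.trans hsc
  have hc := m.cutoffTime_mem hd h1 hr0.le
  have hdiff : Icc 0 m.T \ Icc m.startTime m.cutoffTime =
      Ico 0 m.startTime ∪ Ioc m.cutoffTime m.T := by
    ext s
    simp only [Set.mem_sdiff, mem_Icc, mem_union, mem_Ico, mem_Ioc, not_and, not_le]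
    constructor
    · rintro ⟨⟨a, b⟩, c⟩
      rcases lt_or_ge s m.startTime with h | h
      · exact Or.inl ⟨a, h⟩
      · exact Or.inr ⟨c h, b⟩
    · rintro (⟨a, b⟩ | ⟨a, b⟩)
      · exact ⟨⟨a, (b.trans (hsc.trans hc.2)).le⟩, fun h => absurd b (not_lt.2 h)⟩
      · exact ⟨⟨hc.1.trans a.le, b⟩, fun _ => a⟩
  have hmono : StrictMonoOn m.unitCost (Icc m.startTime m.cutoffTime) :=
    m.strictMonoOn_unitCost fun s hs => (m.unitCost'_pos_iff_startTime_lt hd hb).2 hs.1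
  have hanti : StrictAntiOn m.unitCost (Icc 0 m.startTime) :=
    m.strictAntiOn_unitCost fun s hs => by
      rw [← not_le, m.unitCost'_nonneg_iff_startTime_le hd hb, not_le]; exact hs.2
  constructor
  · intro H
    have hP : P.Nonempty := by
      by_contra hP
      rw [not_nonempty_iff_eq_empty] at hP
      have := H.unitCost_nonneg_of_after (t := 0) ⟨le_rfl, m.T_pos⟩ (by simp [hP])
      rw [unitCost_nonneg_iff] at this
      exact absurd hr0 (not_lt.2 this)
    have hg := H.isGreatest_cutoffTime hd h1 hr0.le hP
    exact H.eq_and_eq_of_right (Subset.antisymm (fun s hs =>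
      ⟨(m.unitCost'_nonneg_iff_startTime_le hd hb).1
        (H.purchasing s hs ((hg.2 hs).trans_lt hc.2)), hg.2 hs⟩)
      (H.Icc_subset_of_strictMonoOn h2.le hg.1 hmono)) hdiff
  · rintro ⟨rfl, rfl⟩
    refine m.isUnitLaw_Icc h2.le hsc.le hc.2.le hdiff.symm
      (fun t ht => m.noUnitGain_coe_iff.2 (Or.inl (hanti ⟨ht.1, ht.2.le⟩ (right_mem_Icc.2 h2.le) ht.2)))
      (fun t ht => (m.unitCost_pos_iff_cutoffTime_lt hd).2 ht.1)
      (fun t ht _ => (m.unitCost'_nonneg_iff_startTime_le hd hb).2 ht.1) ?_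
      (fun h => ((m.unitCost_pos_iff_cutoffTime_lt hd).2 hc.2).le)
    rw [← not_lt, m.unitCost_pos_iff_cutoffTime_lt hd]
    exact lt_irrefl _

/-- The purchasing times form an interval, unless selling is free of cost at all times. -/
lemma IsUnitLaw.ordConnected_or {m : Model} {W P : Set ℝ} (H : m.IsUnitLaw W P) :
    P.OrdConnected ∨ ∀ s, m.unitCost s = 0 := by
  by_cases hVII : (m.d, m.r) ∈ regionVII
  · exact Or.inr fun s => (m.unitCost_eq_zero_of_regionVII hVII s).1
  refine Or.inl ?_
  by_cases hI : (m.d, m.r) ∈ m.regionI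
  · rw [((m.isUnitLaw_iff_regionI hI W P).1 H).2]; exact ordConnected_empty
  by_cases hII : (m.d, m.r) ∈ m.regionII
  · rcases (m.isUnitLaw_iff_regionII hII W P).1 H with h | h
    · rw [h.2]; exact ordConnected_Icc
    · rw [h.2.2]; exact ordConnected_empty
  by_cases hIII : (m.d, m.r) ∈ m.regionIII
  · rw [((m.isUnitLaw_iff_regionIII hIII W P).1 H).2]; exact ordConnected_Icc
  by_cases hIV : (m.d, m.r) ∈ m.regionIV
  · rw [((m.isUnitLaw_iff_regionIV hIV W P).1 H).2]; exact ordConnected_Icc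
  by_cases hV : (m.d, m.r) ∈ m.regionV
  · rw [((m.isUnitLaw_iff_regionV hV W P).1 H).2]; exact ordConnected_singleton
  by_cases hVI : (m.d, m.r) ∈ regionVI
  · rcases (m.isUnitLaw_iff_regionVI hVI W P).1 H with h | h
    · rw [h.2]; exact ordConnected_singleton
    · rw [h.2]; exact ordConnected_empty
  by_cases hVIII : (m.d, m.r) ∈ m.regionVIII
  · rw [((m.isUnitLaw_iff_regionVIII hVIII W P).1 H).2]; exact ordConnected_Icc
  -- What remains is that the eight regions cover all pairs `(d, r)` with `r > 0`.
  exfalso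
  simp only [regionI, regionII, regionIII, regionIV, regionV, regionVI, regionVII, regionVIII,
    mem_ofPred_eq, not_and, not_lt, not_le, mem_singleton_iff, Prod.mk.injEq] at *
  have hb : 0 ≤ m.d → 1 ≤ 1 + m.d / m.bR := fun h => by
    have := div_nonneg h m.bR_pos.le; linarith
  have hb' : m.d < 0 → 1 + m.d / m.bR < 1 := fun h => by
    have := div_neg_of_neg_of_pos h m.bR_pos; linarith
  have hexp : 0 ≤ m.d → Real.exp (-m.T * m.d) ≤ 1 := fun h =>
    Real.exp_le_one_iff.2 (by nlinarith [m.T_pos])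
  rcases lt_trichotomy m.r 1 with hr | hr | hr
  · have h1 : 1 + m.d / m.bR ≤ m.r := by
      by_contra! h; exact absurd (hV h) (not_le.2 hr)
    have hd : m.d < 0 := by
      by_contra! h; linarith [hb h]
    rcases lt_or_ge m.r ((1 + m.d / m.bR) * Real.exp (-m.T * m.d)) with h | h
    · linarith [hIV hr.le h]
    · linarith [hIII hr.le h]
  · rcases lt_trichotomy m.d 0 with hd | hd | hd
    · rcases lt_or_ge m.r ((1 + m.d / m.bR) * Real.exp (-m.T * m.d)) with h | h
      · linarith [hIV hr.le h, hb' hd]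
      · linarith [hIII hr.le h]
    · exact hVII hd hr
    · linarith [hVI hr]
  · have h1 := hI hr
    have hd : m.d < 0 := by
      by_contra! h; linarith [hexp h]
    have h2 := hII hr h1
    linarith [hVIII hr h2]

end Model

/-! ### The insurer's response to a premium rate -/

/-- From every time on, the first point of `A` is attained. -/
def AttainsFirst (T : ℝ) (A : Set ℝ) : Prop :=
  ∀ t ∈ Icc 0 T, (A ∩ Icc t T).Nonempty → ∃ s, IsLeast (A ∩ Icc t T) s

lemma AttainsFirst.firstTime {T : ℝ} {A : Set ℝ} (h : AttainsFirst T A) {t : ℝ}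
    (ht : t ∈ Icc 0 T) :
    (A ∩ Icc t T = ∅ ∧ firstTime (A ∩ Icc t T) = ⊤) ∨
      ∃ s, IsLeast (A ∩ Icc t T) s ∧ firstTime (A ∩ Icc t T) = (s : WithTop ℝ) := by
  rcases (A ∩ Icc t T).eq_empty_or_nonempty with he | hne
  · exact Or.inl ⟨he, by rw [he, firstTime_empty]⟩
  · obtain ⟨s, hs⟩ := h t ht hne
    exact Or.inr ⟨s, hs, firstTime_eq_coe hs⟩

lemma attainsFirst_of_isClosed {A : Set ℝ} (h : IsClosed A) (T : ℝ) : AttainsFirst T A :=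
  fun t _ hne => ⟨_, (h.inter isClosed_Icc).isLeast_csInf hne ⟨t, fun _ hs => hs.2.1⟩⟩

namespace Model

variable (m : Model)

/-- The times at which the insurer accepts the premium rate `c`. -/
def saleTimes (c : ℝ → ℝ) : Set ℝ := {s | s ∈ Icc 0 m.T ∧ c s ≤ m.κ s}

lemma closure_insurerW_subset (c : ℝ → ℝ) : closure (m.insurerW c) ⊆
    {q | q.2.1 ∈ closure (Icc 0 m.T \ m.saleTimes c) ∨ q.2.2 = m.ybar} := by
  refine closure_minimal (fun q hq => ?_) ?_
  · rcases hq.2 with h | h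
    · exact Or.inl (subset_closure ⟨hq.1, fun h' => absurd h.2 (not_lt.2 h'.2)⟩)
    · exact Or.inr h
  · exact (isClosed_closure.preimage (by fun_prop : Continuous fun q : ℝ × ℝ × ℝ => q.2.1)).union
      (isClosed_singleton.preimage (by fun_prop : Continuous fun q : ℝ × ℝ × ℝ => q.2.2))

lemma mem_closure_insurerW {c : ℝ → ℝ} {x s y : ℝ} (hs : s ∈ closure (Icc 0 m.T \ m.saleTimes c))
    (hy : y ∈ Ico 0 m.ybar) : (x, s, y) ∈ closure (m.insurerW c) :=
  map_mem_closure (f := fun u => (x, u, y)) (by fun_prop) hs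
    fun u hu => ⟨hu.1, Or.inl ⟨hy, not_le.1 fun h => hu.2 ⟨hu.1, h⟩⟩⟩

variable {Ω : Type*} [MeasurableSpace Ω] {μ : Measure Ω}

/-- Full coverage always counts as waiting, so the closure constraint matters only before `p`; the
coverage measure charges only `p`, an accepted time at which the prior coverage is still `y`. `p`
need not be the first accepted time, a freedom used in `IsAdmissiblePremium.attainsFirst`. -/
lemma exists_solvesSkorohod_stepPath [IsProbabilityMeasure μ] (S : StochasticBasis Ω μ)
    (c : ℝ → ℝ) (x : ℝ) {t y : ℝ} (ht : t ∈ Icc 0 m.T) (hy : y ∈ Icc 0 m.ybar) {p : WithTop ℝ}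
    (hp : p = ⊤ ∨ ∃ s ∈ m.saleTimes c ∩ Icc t m.T, p = (s : WithTop ℝ))
    (hbefore : ∀ s ∈ Icc t m.T, (s : WithTop ℝ) < p →
      s ∈ closure (Icc 0 m.T \ m.saleTimes c)) :
    ∃ X : ℝ → Ω → ℝ, m.SolvesSkorohod S (m.insurerW c) (m.insurerP c) x t y X
      (fun s _ => stepPath p y m.ybar s) ∧ Integrable (fun ω => X m.T ω ^ 2) μ := by
  obtain ⟨X₀, hX₀, hL⟩ := exists_solvesSDE S S.brownian_BI S.adapted_BI m.aI m.bI m.σI x ht.2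
  have htp : t ≤ p := by
    rcases hp with rfl | ⟨s, hs, rfl⟩
    · exact le_top
    · exact WithTop.coe_le_coe.2 hs.2.1
  refine ⟨_, ⟨⟨fun r hr ω => stepPath_of_lt ((WithTop.coe_lt_coe.2 hr).trans_le htp),
    fun r hr ω => ?_, fun r _ => measurable_const, Eventually.of_forall fun ω =>
      ⟨monotone_stepPath p hy.2, continuousWithinAt_stepPath p y m.ybar, ?_⟩⟩,
    (hX₀.add_jump ht.2 htp (-(m.ybar - y))).congr (Eventually.of_forall fun ω r _ => ?_),
    Eventually.of_forall fun ω r hr => ?_, Eventually.of_forall fun ω => ?_⟩,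
    (hL.add (memLp_const _)).integrable_sq⟩
  · rcases hp with rfl | ⟨s, hs, rfl⟩
    · simp
    · rw [stepPath_of_le (WithTop.coe_le_coe.2 (hs.2.2.trans hr.le)),
        stepPath_of_le (WithTop.coe_le_coe.2 hs.2.2)]
  · unfold stepPath
    split_ifs
    exacts [le_rfl, hy.2]
  · unfold stepPath
    split_ifs <;> ring
  · have hr0 : r ∈ Icc 0 m.T := ⟨ht.1.trans hr.1, hr.2⟩
    rcases le_or_gt p (r : WithTop ℝ) with h | h
    · exact subset_closure ⟨hr0, Or.inr (stepPath_of_le h)⟩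
    · rcases hy.2.eq_or_lt with hyb | hyb
      · exact subset_closure ⟨hr0, Or.inr ((stepPath_of_lt h).trans hyb)⟩
      · simp only [stepPath_of_lt h]
        exact m.mem_closure_insurerW (hbefore r hr h) ⟨hy.1, hyb⟩
  · rcases hp with rfl | ⟨s, hs, rfl⟩
    · change pathMeasure (stepPath ⊤ y m.ybar) _ = 0
      rw [pathMeasure_stepPath_top]; simp
    · change pathMeasure (stepPath s y m.ybar) _ = 0
      rw [pathMeasure_stepPath_coe s hy.2, Measure.smul_apply, smul_eq_mul, mul_eq_zero]
      rcases hy.2.eq_or_lt with hyb | hyb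
      · exact Or.inl (by simp [hyb])
      · refine Or.inr ?_
        rw [Measure.dirac_apply, indicator_of_notMem]
        rintro ⟨-, h⟩
        refine h ⟨hs.1.1, ?_, hs.1.2⟩
        change Function.leftLim (stepPath s y m.ybar) s ∈ _
        rw [leftLim_stepPath_self]
        exact ⟨hy.1, hyb⟩

lemma SolvesSkorohod.ae_eq_of_no_sale {m : Model} {S : StochasticBasis Ω μ} {c : ℝ → ℝ}
    {x t y : ℝ} {X ξ : ℝ → Ω → ℝ}
    (h : m.SolvesSkorohod S (m.insurerW c) (m.insurerP c) x t y X ξ) :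
    ∀ᵐ ω ∂μ, ∀ r ∈ Icc t m.T, (∀ u ∈ Icc t r, u ∉ m.saleTimes c) → ξ r ω = y := by
  filter_upwards [h.coverage.path, h.support] with ω h1 h2 r hr hu
  have h3 : pathMeasure (fun s => ξ s ω) (Icc t r) = 0 := by
    refine measure_mono_null (fun u hu' => ?_) h2
    exact ⟨⟨hu'.1, hu'.2.trans hr.2⟩, fun hP => hu u hu' ⟨hP.1, hP.2.2⟩⟩
  rw [pathMeasure_Icc h1.1 h1.2.1 (fun s hs => h.coverage.before s hs ω),
    ENNReal.ofReal_eq_zero] at h3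
  have h4 : ξ (t - 1) ω ≤ ξ r ω := h1.1 (by linarith [hr.1])
  rw [h.coverage.before (t - 1) (by linarith)] at h4
  linarith

/-- Buying everything at the first accepted time is greatest: before it no solution can buy, and
from then on the ceiling is reached. -/
lemma exists_isGenerated_stepPath [IsProbabilityMeasure μ] (S : StochasticBasis Ω μ) {c : ℝ → ℝ}
    (hc : AttainsFirst m.T (m.saleTimes c)) (x : ℝ) {t y : ℝ} (ht : t ∈ Icc 0 m.T)
    (hy : y ∈ Icc 0 m.ybar) :
    ∃ X : ℝ → Ω → ℝ, m.IsGenerated S (m.insurerW c) (m.insurerP c) x t y X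
      (fun s _ => stepPath (firstTime (m.saleTimes c ∩ Icc t m.T)) y m.ybar s) ∧
      Integrable (fun ω => X m.T ω ^ 2) μ := by
  have hfirst := hc.firstTime ht
  set p := firstTime (m.saleTimes c ∩ Icc t m.T)
  have hnot : ∀ r ∈ Icc t m.T, (r : WithTop ℝ) < p → ∀ u ∈ Icc t r, u ∉ m.saleTimes c := by
    intro r hr hrp u hu huA
    have huI : u ∈ m.saleTimes c ∩ Icc t m.T := ⟨huA, hu.1, hu.2.trans hr.2⟩
    rcases hfirst with h | ⟨s, hs, h⟩
    · rw [h.1] at huI; exact huI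
    · rw [h] at hrp
      exact absurd (WithTop.coe_lt_coe.1 hrp) (not_lt.2 ((hs.2 huI).trans hu.2))
  obtain ⟨X, hX, hI⟩ := m.exists_solvesSkorohod_stepPath S c x ht hy (p := p)
    (hfirst.imp (fun h => h.2) fun ⟨s, hs, h⟩ => ⟨s, hs.1, h⟩)
    (fun r hr hrp => subset_closure ⟨⟨ht.1.trans hr.1, hr.2⟩,
      hnot r hr hrp r ⟨hr.1, le_rfl⟩⟩)
  refine ⟨X, ⟨hX, fun X' ξ' h' => ?_⟩, hI⟩
  filter_upwards [h'.ae_eq_of_no_sale, h'.coverage.path] with ω h1 h2 r hr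
  rcases le_or_gt p (r : WithTop ℝ) with h | h
  · rw [stepPath_of_le h]
    exact (h2.1 hr.2).trans h2.2.2
  · rw [stepPath_of_lt h]
    exact (h1 r hr (hnot r hr h)).le

/-- If the infimum `p` of the accepted times were not accepted, take accepted `q n` tending to `p`.
The greatest solution started with no coverage is full by each `q n`, hence full at `p` by right
continuity; yet nothing can be bought on `[t, p]`. -/
lemma IsAdmissiblePremium.attainsFirst [IsProbabilityMeasure μ] {m : Model}
    {S : StochasticBasis Ω μ} {c : ℝ → ℝ} (hc : m.IsAdmissiblePremium S c) :
    AttainsFirst m.T (m.saleTimes c) := by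
  intro t ht hne
  set A := m.saleTimes c ∩ Icc t m.T with hA
  have hbdd : BddBelow A := ⟨t, fun _ hs => hs.2.1⟩
  set p := sInf A with hp
  refine ⟨p, ?_, fun s hs => csInf_le hbdd hs⟩
  by_contra hpA
  have htp : t ≤ p := le_csInf hne fun s hs => hs.2.1
  have hpT : p ≤ m.T := by
    obtain ⟨s, hs⟩ := hne
    exact (csInf_le hbdd hs).trans hs.2.2
  obtain ⟨q, -, hqlim, hqA⟩ := exists_seq_tendsto_sInf hne hbdd
  obtain ⟨X, ξ, hgen, -⟩ := hc.2.2.2 0 t 0 ⟨ht, le_rfl, m.ybar_pos.le⟩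
  have hfull : ∀ n, ∀ᵐ ω ∂μ, m.ybar ≤ ξ (q n) ω := fun n => by
    -- Either buying everything at `q n` is itself a solution, dominated by the greatest one, or
    -- some earlier time is outside the closure of the refused times and the waiting constraint
    -- already forces full coverage there.
    by_cases hcl : ∀ s ∈ Icc t m.T, ((s : ℝ) : WithTop ℝ) < ((q n : ℝ) : WithTop ℝ) →
        s ∈ closure (Icc 0 m.T \ m.saleTimes c)
    · obtain ⟨X', h', -⟩ := m.exists_solvesSkorohod_stepPath S c 0 ht ⟨le_rfl, m.ybar_pos.le⟩
        (Or.inr ⟨q n, hqA n, rfl⟩) hcl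
      filter_upwards [hgen.2 X' _ h'] with ω hω
      have := hω (q n) (hqA n).2
      rwa [stepPath_of_le le_rfl] at this
    · push Not at hcl
      obtain ⟨s, hs, hsq, hscl⟩ := hcl
      filter_upwards [hgen.1.mem_closure, hgen.1.coverage.path] with ω h1 h2
      rcases m.closure_insurerW_subset c (h1 s hs) with h | h
      · exact absurd h hscl
      · exact h.ge.trans (h2.1 (WithTop.coe_lt_coe.1 hsq).le)
  have hfalse : ∀ᵐ ω ∂μ, False := by
    filter_upwards [ae_all_iff.2 hfull, hgen.1.ae_eq_of_no_sale, hgen.1.coverage.path]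
      with ω h1 h2 h3
    have h4 : Tendsto (fun n => ξ (q n) ω) atTop (𝓝 (ξ p ω)) :=
      (h3.2.1 p).tendsto.comp (tendsto_nhdsWithin_iff.2
        ⟨hqlim, Eventually.of_forall fun n => csInf_le hbdd (hqA n)⟩)
    have h5 : m.ybar ≤ ξ p ω := ge_of_tendsto' h4 h1
    have h6 : ξ p ω = 0 := h2 p ⟨htp, hpT⟩ fun u hu huA => by
      have huA' : u ∈ A := ⟨huA, hu.1, hu.2.trans hpT⟩
      rcases hu.2.eq_or_lt with rfl | hlt
      · exact hpA huA'
      · exact absurd (csInf_le hbdd huA') (not_le.2 hlt)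
    linarith [m.ybar_pos]
  exact hfalse.exists.choose_spec

lemma insurerW_union_insurerP (c : ℝ → ℝ) : m.insurerW c ∪ m.insurerP c = m.stateSpace := by
  ext q
  constructor
  · rintro (⟨h1, h2 | h2⟩ | ⟨h1, h2, -⟩)
    · exact ⟨h1, Ico_subset_Icc_self h2.1⟩
    · exact ⟨h1, by rw [h2]; exact ⟨m.ybar_pos.le, le_rfl⟩⟩
    · exact ⟨h1, Ico_subset_Icc_self h2⟩
  · rintro ⟨h1, h2⟩
    rcases h2.2.eq_or_lt with h | h
    · exact Or.inl ⟨h1, Or.inr h⟩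
    · rcases lt_or_ge (m.κ q.2.1) (c q.2.1) with h3 | h3
      · exact Or.inl ⟨h1, Or.inl ⟨⟨h2.1, h⟩, h3⟩⟩
      · exact Or.inr ⟨h1, ⟨h2.1, h⟩, h3⟩

lemma disjoint_insurerW_insurerP (c : ℝ → ℝ) : Disjoint (m.insurerW c) (m.insurerP c) := by
  refine disjoint_left.2 ?_
  rintro q ⟨-, h | h⟩ ⟨-, h2, h3⟩
  · exact absurd h.2 (not_lt.2 h3)
  · exact absurd h2.2 (not_lt.2 h.ge)

lemma isAdmissiblePremium_of_attainsFirst [IsProbabilityMeasure μ] (S : StochasticBasis Ω μ)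
    {c : ℝ → ℝ} (hc0 : ∀ t ∈ Icc 0 m.T, 0 ≤ c t) (hc : AttainsFirst m.T (m.saleTimes c)) :
    m.IsAdmissiblePremium S c := by
  refine ⟨hc0, m.insurerW_union_insurerP c, m.disjoint_insurerW_insurerP c, fun x t y hq => ?_⟩
  obtain ⟨X, hX, hI⟩ := m.exists_isGenerated_stepPath S hc x hq.1 hq.2
  refine ⟨X, _, hX, hI, (lintegral_mono fun ω =>
    lintegral_pathMeasure_stepPath_le t m.T _ hq.2.2
      fun s => Real.exp (m.ρI * (m.T - s)) * c s).trans_lt ?_⟩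
  rw [lintegral_const, measure_univ, mul_one]
  exact ENNReal.mul_lt_top ENNReal.ofReal_lt_top ENNReal.ofReal_lt_top

lemma exists_JR_eq [IsProbabilityMeasure μ] (S : StochasticBasis Ω μ) {t : ℝ}
    (ht : t ∈ Icc 0 m.T) (z : ℝ) :
    ∃ C : ℝ, ∀ (x y : ℝ) (c : ℝ → ℝ), y ∈ Icc 0 m.ybar → AttainsFirst m.T (m.saleTimes c) →
      m.JR S x t y z c =
        C + (m.ybar - y) * m.saleCost c (firstTime (m.saleTimes c ∩ Icc t m.T)) := by
  obtain ⟨C, hC⟩ := m.exists_coverageCost_eq S ht.2 z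
  refine ⟨C, fun x y c hy hc => ?_⟩
  obtain ⟨X, hX, -⟩ := m.exists_isGenerated_stepPath S hc x ht hy
  have hex : ∃ ξ : ℝ → Ω → ℝ, ∃ X, m.IsGenerated S (m.insurerW c) (m.insurerP c) x t y X ξ :=
    ⟨_, X, hX⟩
  obtain ⟨X', hX'⟩ := Classical.epsilon_spec hex
  refine hC y c _ _ hy.2 ((hc.firstTime ht).imp (fun h => h.2) fun ⟨s, hs, h⟩ => ⟨s, hs.1.2, h⟩) ?_
  -- Two greatest solutions dominate each other, so the chosen one is the step path on `[t, T]`;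
  -- outside, the constant extensions fix it.
  filter_upwards [hX.2 _ _ hX'.1, hX'.2 _ _ hX.1] with ω h1 h2 s
  have hIcc : ∀ r ∈ Icc t m.T, _ := fun r hr => (h1 r hr).antisymm (h2 r hr)
  rcases lt_or_ge s t with hs | hs
  · rw [hX'.1.coverage.before s hs]
    exact (hX.1.coverage.before s hs ω).symm
  rcases le_or_gt s m.T with hsT | hsT
  · exact hIcc s ⟨hs, hsT⟩
  · rw [hX'.1.coverage.after s hsT, hIcc m.T ⟨ht.2, le_rfl⟩]
    exact (hX.1.coverage.after s hsT ω).symm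

/-! ### Pasted premiums and the equilibrium property -/

lemma saleTimes_paste (s : ℝ) (c₁ c₂ : ℝ → ℝ) : m.saleTimes (paste s c₁ c₂) =
    (m.saleTimes c₁ ∩ Iio s) ∪ (m.saleTimes c₂ ∩ Ici s) := by
  ext u
  by_cases h : u < s
  · simp [saleTimes, paste, h]
  · simp [saleTimes, paste, h, not_lt.1 h]

lemma attainsFirst_paste {c₁ c₂ : ℝ → ℝ} (h₁ : AttainsFirst m.T (m.saleTimes c₁))
    (h₂ : AttainsFirst m.T (m.saleTimes c₂)) (s : ℝ) :
    AttainsFirst m.T (m.saleTimes (paste s c₁ c₂)) := by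
  intro t ht hne
  rw [saleTimes_paste] at hne ⊢
  by_cases hex : ∃ u ∈ m.saleTimes c₁ ∩ Icc t m.T, u < s
  · obtain ⟨u, hu, hus⟩ := hex
    obtain ⟨q, hq⟩ := h₁ t ht ⟨u, hu⟩
    have hqs : q < s := (hq.2 hu).trans_lt hus
    refine ⟨q, ⟨Or.inl ⟨hq.1.1, hqs⟩, hq.1.2⟩, ?_⟩
    rintro v ⟨hv | hv, hvI⟩
    · exact hq.2 ⟨hv.1, hvI⟩
    · exact hqs.le.trans hv.2
  · push Not at hex
    have hall : ∀ v, v ∈ (m.saleTimes c₁ ∩ Iio s ∪ m.saleTimes c₂ ∩ Ici s) ∩ Icc t m.T →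
        v ∈ m.saleTimes c₂ ∩ Icc (max t s) m.T := by
      rintro v ⟨hv | hv, hvI⟩
      · exact absurd (hex v ⟨hv.1, hvI⟩) (not_le.2 hv.2)
      · exact ⟨hv.1, max_le hvI.1 hv.2, hvI.2⟩
    obtain ⟨v, hv⟩ := hne
    have hv' := hall v hv
    obtain ⟨q, hq⟩ := h₂ (max t s) ⟨ht.1.trans (le_max_left _ _), hv'.2.1.trans hv'.2.2⟩ ⟨v, hv'⟩
    exact ⟨q, ⟨Or.inr ⟨hq.1.1, (le_max_right _ _).trans hq.1.2.1⟩,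
      (le_max_left _ _).trans hq.1.2.1, hq.1.2.2⟩, fun w hw => hq.2 (hall w hw)⟩

/-- An accepted premium is at most `κ`, so no deviation sells more cheaply for the reinsurer than
the threshold premium at the same time. -/
lemma unitCost_le_saleCost {c : ℝ → ℝ} {s : ℝ} (h : c s ≤ m.κ s) :
    m.unitCost s ≤ m.saleCost c (s : WithTop ℝ) := by
  rw [← saleCost_κ, saleCost_coe, saleCost_coe]
  have h1 := mul_le_mul_of_nonneg_left h (Real.exp_pos (m.ρR * (m.T - s))).le
  have h2 := mul_le_mul_of_nonneg_left h1 m.θR_pos.le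
  linarith

lemma saleCost_congr {c c' : ℝ → ℝ} {s : ℝ} (h : c s = c' s) :
    m.saleCost c (s : WithTop ℝ) = m.saleCost c' (s : WithTop ℝ) := by
  rw [saleCost_coe, saleCost_coe, h]

namespace IsUnitLaw

variable {m : Model} {W P : Set ℝ}

lemma saleTimes_eq (H : m.IsUnitLaw W P) {c : ℝ → ℝ} (hc : m.GeneratesPremium W P c) :
    m.saleTimes c = P := by
  ext s
  refine ⟨fun hs => ?_, fun hs => ⟨H.division.subset_right hs, (hc.1 s hs).le⟩⟩
  by_contra hP
  exact absurd (hc.2 s (H.division.mem_left hs.1 hP)) (not_lt.2 hs.2)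

lemma saleCost_firstTime (H : m.IsUnitLaw W P) {c : ℝ → ℝ} (hc : m.GeneratesPremium W P c)
    (t : ℝ) : m.saleCost c (firstTime (P ∩ Icc t m.T)) =
      m.saleCost m.κ (firstTime (P ∩ Icc t m.T)) := by
  rcases H.division.firstTime_Icc t with h | ⟨s, hs, h⟩
  · rw [h.2]; rfl
  · rw [h]; exact m.saleCost_congr (hc.1 s hs.1.1)

lemma noUnitGain (H : m.IsUnitLaw W P) {t : ℝ} (ht : t ∈ Ico 0 m.T) :
    m.NoUnitGain t (firstTime (P ∩ Icc t m.T)) := by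
  by_cases hP : t ∈ P
  · rw [firstTime_eq_coe (A := P ∩ Icc t m.T) (s := t) ⟨⟨hP, le_rfl, ht.2.le⟩, fun s hs => hs.2.1⟩,
      noUnitGain_self_iff]
    exact H.purchasing t hP ht.2
  · exact H.waiting t (H.division.mem_left ⟨ht.1, ht.2.le⟩ hP) ht.2

/-- Suspending the sale for a time `h` is, to first order in `h`, not better. -/
lemma eventually_le_saleCost_firstTime (H : m.IsUnitLaw W P) {t : ℝ} (ht : t ∈ Ico 0 m.T) {ε : ℝ}
    (hε : 0 < ε) : ∀ᶠ h in 𝓝[>] (0 : ℝ), -(ε * h) ≤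
      m.saleCost m.κ (firstTime (P ∩ Icc (t + h) m.T)) -
        m.saleCost m.κ (firstTime (P ∩ Icc t m.T)) := by
  -- For an interval `P` three cases remain: `P` continues to the right of `t`, so the sale moves to
  -- `t + h`; `t` is the last sale, which is then lost; or `t ∉ P`, and a short suspension leaves
  -- the next sale unchanged.
  rcases H.ordConnected_or with hP | h0
  · by_cases htP : t ∈ P
    · have hfirst : firstTime (P ∩ Icc t m.T) = (t : WithTop ℝ) :=
        firstTime_eq_coe ⟨⟨htP, le_rfl, ht.2.le⟩, fun s hs => hs.2.1⟩
      by_cases hex : ∃ u ∈ P, t < u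
      · obtain ⟨u, hu, htu⟩ := hex
        filter_upwards [(H.noUnitGain ht).eventually hε, Ioo_mem_nhdsGT (sub_pos.2 htu)] with k h1 h2
        have hk : t + k ∈ P := hP.out htP hu ⟨by linarith [h2.1], by linarith [h2.2]⟩
        have := h1 k ⟨h2.1.le, le_rfl⟩
        rwa [firstTime_eq_coe (A := P ∩ Icc (t + k) m.T) (s := t + k)
          ⟨⟨hk, le_rfl, (H.division.subset_right hk).2⟩, fun s hs => hs.2.1⟩, saleCost_κ]
      · push Not at hex
        have hle := H.unitCost_nonpos_of_isGreatest ⟨htP, fun u hu => hex u hu⟩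
        filter_upwards [self_mem_nhdsWithin] with k hk
        have hk0 : 0 < k := hk
        rw [show P ∩ Icc (t + k) m.T = ∅ from eq_empty_of_forall_notMem fun s hs => by
          linarith [hex s hs.1, hs.2.1], firstTime_empty, saleCost_top, hfirst, saleCost_κ]
        have := mul_pos hε hk0
        linarith
    · obtain ⟨η, hη, hball⟩ := Metric.mem_nhds_iff.1 (H.division.2.2.isOpen_compl.mem_nhds htP)
      filter_upwards [Ioo_mem_nhdsGT hη] with k hk
      have : P ∩ Icc (t + k) m.T = P ∩ Icc t m.T := by
        ext s
        refine ⟨fun hs => ⟨hs.1, by linarith [hs.2.1, hk.1], hs.2.2⟩,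
          fun hs => ⟨hs.1, ?_, hs.2.2⟩⟩
        by_contra! hlt
        refine hball (?_ : s ∈ _) hs.1
        rw [Metric.mem_ball, Real.dist_eq, abs_of_nonneg (sub_nonneg.2 hs.2.1)]
        linarith [hk.2]
      rw [this, sub_self]
      have := mul_pos hε hk.1
      linarith
  · have hs : ∀ p : WithTop ℝ, m.saleCost m.κ p = 0 := fun p => by
      induction p using WithTop.recTopCoe with
      | top => rfl
      | coe p => rw [saleCost_κ, h0]
    filter_upwards [self_mem_nhdsWithin] with k hk
    have := mul_pos hε (show 0 < k from hk)
    rw [hs, hs]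
    linarith

lemma isEquilibriumPremium [IsProbabilityMeasure μ] (H : m.IsUnitLaw W P)
    (S : StochasticBasis Ω μ) {c : ℝ → ℝ} (hc : m.GeneratesPremium W P c) :
    m.IsEquilibriumPremium S c := by
  have hA := H.saleTimes_eq hc
  have hfirst : AttainsFirst m.T (m.saleTimes c) := by
    rw [hA]; exact attainsFirst_of_isClosed H.division.2.2 m.T
  have hc0 : ∀ t ∈ Icc 0 m.T, 0 ≤ c t := fun t ht => by
    by_cases hP : t ∈ P
    · exact hc.1 t hP ▸ (m.κ_pos t).le
    · exact ((m.κ_pos t).trans (hc.2 t (H.division.mem_left ht hP))).le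
  refine ⟨m.isAdmissiblePremium_of_attainsFirst S hc0 hfirst,
    fun x z t ht y hy c' hc' => ?_, fun x z y hy c' hc' => ?_⟩
  · have htI : t ∈ Icc 0 m.T := ⟨ht.1, ht.2.le⟩
    obtain ⟨C, hC⟩ := m.exists_JR_eq S htI z
    have hy0 : 0 ≤ m.ybar - y := sub_nonneg.2 hy.2
    have hfirst' := hc'.attainsFirst
    refine (zero_le_liminf_coe_iff _).2 fun ε hε => ?_
    -- The added `1` keeps the denominator positive when `y = ybar`.
    have hε' : 0 < ε / (m.ybar - y + 1) := by positivity
    filter_upwards [(H.noUnitGain ht).eventually hε', H.eventually_le_saleCost_firstTime ht hε',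
      self_mem_nhdsWithin] with h h1 h2 h3
    have h3 : 0 < h := h3
    have hpaste := m.attainsFirst_paste hfirst' hfirst (t + h)
    have hkey : -(ε / (m.ybar - y + 1) * h) ≤ m.saleCost (paste (t + h) c' c)
        (firstTime (m.saleTimes (paste (t + h) c' c) ∩ Icc t m.T)) -
        m.saleCost m.κ (firstTime (P ∩ Icc t m.T)) := by
      -- If the pasted premium sells before `t + h`, the local condition applies with delay `s - t`.
      -- Otherwise the accepted times are those of `P` from `t + h` on, and the suspension estimate
      -- applies.
      by_cases hex : ∃ s, IsLeast (m.saleTimes (paste (t + h) c' c) ∩ Icc t m.T) s ∧ s < t + h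
      · obtain ⟨s, hs, hsh⟩ := hex
        rw [firstTime_eq_coe hs]
        have h4 := m.unitCost_le_saleCost hs.1.1.2
        have h5 := h1 (s - t) ⟨sub_nonneg.2 hs.1.2.1, by linarith⟩
        rw [add_sub_cancel] at h5
        linarith
      · have hset : m.saleTimes (paste (t + h) c' c) ∩ Icc t m.T = P ∩ Icc (t + h) m.T := by
          ext s
          constructor
          · intro hs
            obtain ⟨q, hq⟩ := hpaste t htI ⟨s, hs⟩
            have hsh : t + h ≤ s := by
              by_contra! hlt
              exact hex ⟨q, hq, (hq.2 hs).trans_lt hlt⟩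
            have hs1 := hs.1
            rw [saleTimes_paste, hA] at hs1
            rcases hs1 with hs1 | hs1
            · exact absurd hs1.2 (not_lt.2 hsh)
            · exact ⟨hs1.1, hsh, hs.2.2⟩
          · intro hs
            refine ⟨?_, by linarith [hs.2.1], hs.2.2⟩
            rw [saleTimes_paste, hA]
            exact Or.inr ⟨hs.1, hs.2.1⟩
        rw [hset]
        rcases H.division.firstTime_Icc (t + h) with h4 | ⟨s, hs, h4⟩
        · rw [h4.2] at h2 ⊢
          exact h2
        · rw [h4] at h2 ⊢
          have : paste (t + h) c' c s = m.κ s := by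
            rw [paste, if_neg (not_lt.2 hs.1.2.1), hc.1 s hs.1.1]
          rwa [m.saleCost_congr this]
    rw [hC x y _ hy hpaste, hC x y _ hy hfirst, hA, H.saleCost_firstTime hc, add_sub_add_left_eq_sub,
      ← mul_sub, le_div_iff₀ h3]
    refine le_trans ?_ (mul_le_mul_of_nonneg_left hkey hy0)
    have h6 : (m.ybar - y) * (ε / (m.ybar - y + 1)) ≤ ε := by
      rw [mul_div_assoc', div_le_iff₀ (by linarith)]
      nlinarith
    have := mul_le_mul_of_nonneg_right h6 h3.le
    linarith
  · have hTI : m.T ∈ Icc 0 m.T := ⟨m.T_pos.le, le_rfl⟩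
    obtain ⟨C, hC⟩ := m.exists_JR_eq S hTI z
    have hfirst' := hc'.attainsFirst
    rw [hC x y _ hy hfirst', hC x y _ hy hfirst, hA, H.saleCost_firstTime hc,
      add_sub_add_left_eq_sub, ← mul_sub]
    refine mul_nonneg (sub_nonneg.2 hy.2) (sub_nonneg.2 ?_)
    -- At the horizon a deviation either does not sell, at cost zero, or sells for at least
    -- `unitCost T`; the end conditions of the law handle both.
    have hv' : 0 = m.saleCost c' (firstTime (m.saleTimes c' ∩ Icc m.T m.T)) ∨
        m.unitCost m.T ≤ m.saleCost c' (firstTime (m.saleTimes c' ∩ Icc m.T m.T)) := by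
      rcases hfirst'.firstTime hTI with h | ⟨s, hs, h⟩
      · rw [h.2]; exact Or.inl rfl
      · rw [h]
        obtain rfl : s = m.T := le_antisymm hs.1.2.2 hs.1.2.1
        exact Or.inr (m.unitCost_le_saleCost hs.1.1.2)
    rcases H.division.firstTime_Icc m.T with h | ⟨s, hs, h⟩
    · rw [h.2, saleCost_top]
      have hTW : m.T ∈ W := H.division.mem_left hTI fun hP => by
        have : m.T ∈ P ∩ Icc m.T m.T := ⟨hP, le_rfl, le_rfl⟩
        rw [h.1] at this; exact this
      rcases hv' with hv | hv
      · exact hv.le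
      · exact (H.waiting_end hTW).trans hv
    · obtain rfl : s = m.T := le_antisymm hs.1.2.2 hs.1.2.1
      rw [h, saleCost_κ]
      rcases hv' with hv | hv
      · rw [← hv]; exact H.purchasing_end hs.1.1
      · exact hv

end IsUnitLaw

end Model

end Reinsurance

theorem theorem4p1 {Ω : Type*} [MeasurableSpace Ω] (μ : Measure Ω) [IsProbabilityMeasure μ]
    (S : Reinsurance.StochasticBasis Ω μ) (m : Reinsurance.Model) :
    ((m.d, m.r) ∈ m.regionI → ∀ W P : Set ℝ,
      m.IsEquilibriumLaw S W P ↔ W = Icc 0 m.T ∧ P = ∅) ∧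
    ((m.d, m.r) ∈ m.regionII → ∀ W P : Set ℝ,
      m.IsEquilibriumLaw S W P ↔
        (W = Ioc m.cutoffTime m.T ∧ P = Icc 0 m.cutoffTime) ∨
        (m.r = Real.exp (-m.T * m.d) ∧ W = Icc 0 m.T ∧ P = ∅)) ∧
    ((m.d, m.r) ∈ m.regionIII → ∀ W P : Set ℝ,
      m.IsEquilibriumLaw S W P ↔ W = ∅ ∧ P = Icc 0 m.T) ∧
    ((m.d, m.r) ∈ m.regionIV → ∀ W P : Set ℝ,
      m.IsEquilibriumLaw S W P ↔ W = Ico 0 m.startTime ∧ P = Icc m.startTime m.T) ∧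
    ((m.d, m.r) ∈ m.regionV → ∀ W P : Set ℝ,
      m.IsEquilibriumLaw S W P ↔ W = Ico 0 m.T ∧ P = {m.T}) ∧
    ((m.d, m.r) ∈ Reinsurance.Model.regionVI → ∀ W P : Set ℝ,
      m.IsEquilibriumLaw S W P ↔
        (W = Ico 0 m.T ∧ P = {m.T}) ∨ (W = Icc 0 m.T ∧ P = ∅)) ∧
    ((m.d, m.r) ∈ Reinsurance.Model.regionVII → ∀ W P : Set ℝ,
      m.IsEquilibriumLaw S W P ↔ Reinsurance.IsDivision m.T W P) ∧
    ((m.d, m.r) ∈ m.regionVIII → ∀ W P : Set ℝ,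
      m.IsEquilibriumLaw S W P ↔
        W = Ico 0 m.startTime ∪ Ioc m.cutoffTime m.T ∧
        P = Icc m.startTime m.cutoffTime) ∧
    (∀ W P : Set ℝ, m.IsEquilibriumLaw S W P → ∀ c : ℝ → ℝ, m.GeneratesPremium W P c →
      m.IsEquilibriumPremium S c) := by
  refine ⟨fun h W P => ?_, fun h W P => ?_, fun h W P => ?_, fun h W P => ?_, fun h W P => ?_,
    fun h W P => ?_, fun h W P => ?_, fun h W P => ?_, fun W P H c hc => ?_⟩
  · exact (m.isEquilibriumLaw_iff S W P).trans (m.isUnitLaw_iff_regionI h W P)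
  · exact (m.isEquilibriumLaw_iff S W P).trans (m.isUnitLaw_iff_regionII h W P)
  · exact (m.isEquilibriumLaw_iff S W P).trans (m.isUnitLaw_iff_regionIII h W P)
  · exact (m.isEquilibriumLaw_iff S W P).trans (m.isUnitLaw_iff_regionIV h W P)
  · exact (m.isEquilibriumLaw_iff S W P).trans (m.isUnitLaw_iff_regionV h W P)
  · exact (m.isEquilibriumLaw_iff S W P).trans (m.isUnitLaw_iff_regionVI h W P)
  · exact (m.isEquilibriumLaw_iff S W P).trans (m.isUnitLaw_iff_regionVII h W P)
  · exact (m.isEquilibriumLaw_iff S W P).trans (m.isUnitLaw_iff_regionVIII h W P)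
  · exact ((m.isEquilibriumLaw_iff S W P).1 H).isEquilibriumPremium S hc
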